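/- All rings are associative. A subring of a ring need not contain a multiplicative identity. A cover of a ring $R$ is a collection of proper subrings of $R$ whose union is $R$; the covering number $\sigma(R)$ is the smallest size of a cover of $R$, with $\sigma(R)=\infty$ if $R$ has no finite cover. For $n\ge 3$ let $S(n)$ be the collection of isomorphism classes of unital rings $R$ such that $\sigma(R)=n$ and $\sigma(R/I)>n$ for every nonzero two-sided ideal $I$ of $R$. Let $F_q$ be the field with $q$ elements, $M_2(F_q)$ the ring of $2\times 2$ matrices over $F_q$, and $T_2(F_q)$ its subring of upper triangular matrices. **Theorem 2.** Let $R\in S(4)$. a) If $|R|=3^t$ for some integer $t\ge 0$, then $R\cong F_3[x,y]/(x^2,xy,y^2)$ or $R\cong T_2(F_3)$. b) If $|R|=2^t$ for some integer $t\ge 0$, then $R\cong F_4\times F_4$ or $R\cong M_2(F_2)$. Moreover, a unital ring belongs to $S(4)$ if and only if it is isomorphic to one of the four rings $F_3[x,y]/(x^2,xy,y^2)$, $T_2(F_3)$, $F_4\times F_4$, $M_2(F_2)$. -/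

import Mathlib

/-- A cover of `R`: a collection of proper subrings, not required to have a
multiplicative unit, whose union is `R`. -/
def IsRingCover {R : Type*} [NonUnitalRing R] (C : Set (NonUnitalSubring R)) : Prop :=
  (∀ S ∈ C, S ≠ ⊤) ∧ ∀ r : R, ∃ S ∈ C, r ∈ S

/-- The covering number `σ(R)`: the minimal size of a cover of `R`. It is `⊤` when `R` has no
finite cover, in particular when `R` has no cover at all. -/
noncomputable def coveringNumber (R : Type*) [NonUnitalRing R] : ℕ∞ :=
  ⨅ C : {C : Set (NonUnitalSubring R) // IsRingCover C}, C.1.encard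

/-- Membership of the unital ring `R` in `S(n)`: the covering number of `R` is `n`, and every
proper quotient (a quotient by a nonzero two-sided ideal) has a larger covering number. -/
def MemS (n : ℕ) (R : Type*) [Ring R] : Prop :=
  coveringNumber R = n ∧
    ∀ I : TwoSidedIdeal R, I ≠ ⊥ → (n : ℕ∞) < coveringNumber I.ringCon.Quotient

/-- The ring `F[x, y] / (x², xy, y²)`. -/
abbrev TruncatedPoly (F : Type*) [CommRing F] : Type _ :=
  MvPolynomial (Fin 2) F ⧸
    (Ideal.span {MvPolynomial.X 0 ^ 2, MvPolynomial.X 0 * MvPolynomial.X 1,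
      MvPolynomial.X 1 ^ 2} : Ideal (MvPolynomial (Fin 2) F))

/-- The ring `T₂(F)` of upper triangular `2 × 2` matrices over `F`. -/
def upperTriangular (F : Type*) [CommRing F] : Subring (Matrix (Fin 2) (Fin 2) F) where
  carrier := {M | M 1 0 = 0}
  zero_mem' := by simp
  one_mem' := by simp
  add_mem' := by
    intro a b ha hb
    simp only [Set.mem_ofPred_eq] at ha hb ⊢
    simp [ha, hb]
  neg_mem' := by
    intro a ha
    simp only [Set.mem_ofPred_eq] at ha ⊢
    simp [ha]
  mul_mem' := by
    intro a b ha hb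
    simp only [Set.mem_ofPred_eq] at ha hb ⊢
    simp [Matrix.mul_apply, Fin.sum_univ_two, ha, hb]

/-! Membership of the four rings is checked on explicit data. Each has a cover by four subrings, and
each contains four elements any two of which generate it as a non-unital ring, so no proper subring
contains two of them and `σ = 4`. Modulo any nonzero ideal a single element generates, so every
proper quotient has `σ = ∞`.

Conversely, a ring in `S(4)` is isomorphic to any homomorphic image with `σ ≤ 4`
(`MemS.nonempty_ringEquiv`), so it suffices to map `R` onto one of the four rings. An irredundant
cover of an abelian group by four subgroups is restricted by B. H. Neumann's inequality `∑ 1/index ≥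
1`, applied to the group and to the cosets of one member: either two members have index 2, or all
have index 3 and the pairwise intersections coincide (`AddSubgroup.irredundant_cover_four`).

In the index 3 case the members are the kernels of `f`, `g`, `f + g`, `f - g` for independent `f`,
`g` into `F₃`. That all four kernels are multiplicatively closed forces `f` and `g` to be
derivations over one pair of characters (`exists_characters_of_ker_mul`). Equal characters lead to
`F₃[x,y]/(x²,xy,y²)`, distinct ones to `T₂(F₃)`.

In the index 2 case all members may be taken unital (`one_mem_of_cover`). A unital subring of index
2 comes from a representation of `R` in `M₂(F₂)`, whose image is everything, fixes a line, or is a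
copy of `F₄` (`MemS.index_two_cases`). Fixing a line gives a derivation into `F₂`; two such members
would yield a cover by three subrings. Two members of field type give a map onto `F₄ × F₄`. One
member of each type forces a third member of index 2, and two of the three then share a type. -/

/-! ### Covering numbers: bounds, images and quotients. -/

/-- A finite family of proper subrings covering `R` bounds the covering number. -/
theorem coveringNumber_le_of_family {R : Type*} [NonUnitalRing R] {n : ℕ}
    (H : Fin n → NonUnitalSubring R) (hH : ∀ i, H i ≠ ⊤) (hcov : ∀ r, ∃ i, r ∈ H i) :
    coveringNumber R ≤ n := by
  have hC : IsRingCover (Set.range H) :=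
    ⟨by rintro _ ⟨i, rfl⟩; exact hH i, fun r => by
      obtain ⟨i, hi⟩ := hcov r
      exact ⟨_, ⟨i, rfl⟩, hi⟩⟩
  refine (iInf_le _ ⟨Set.range H, hC⟩).trans ?_
  show (Set.range H).encard ≤ n
  rw [← Set.image_univ]
  refine (Set.encard_image_le _ _).trans ?_
  simp [Set.encard_univ]

/-- A finite covering number is attained by a family of that size. -/
theorem exists_family_of_coveringNumber_eq {R : Type*} [NonUnitalRing R] {n : ℕ}
    (h : coveringNumber R = n) :
    ∃ H : Fin n → NonUnitalSubring R, (∀ i, H i ≠ ⊤) ∧ ∀ r, ∃ i, r ∈ H i := by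
  have hne : Nonempty {C : Set (NonUnitalSubring R) // IsRingCover C} := by
    by_contra hemp
    rw [not_nonempty_iff] at hemp
    have htop : coveringNumber R = ⊤ := iInf_of_empty _
    exact ENat.natCast_ne_top n (h.symm.trans htop)
  obtain ⟨⟨C, hC⟩, hCe⟩ := ENat.exists_eq_iInf
    (fun C : {C : Set (NonUnitalSubring R) // IsRingCover C} => C.1.encard)
  have hCn : C.encard = n := hCe.trans h
  have hfin : C.Finite := Set.finite_of_encard_eq_coe hCn
  have hcard : Nat.card C = n := by
    have := hCn
    rw [hfin.encard_eq_coe] at this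
    exact_mod_cast this
  have : Finite C := hfin
  let e : Fin n ≃ C := (Finite.equivFinOfCardEq hcard).symm
  refine ⟨fun i => (e i).1, fun i => hC.1 _ (e i).2, fun r => ?_⟩
  obtain ⟨S, hS, hr⟩ := hC.2 r
  exact ⟨e.symm ⟨S, hS⟩, by simpa using hr⟩

/-- A cover of a homomorphic image pulls back. -/
theorem coveringNumber_le_of_surjective {A B : Type*} [NonUnitalRing A] [NonUnitalRing B]
    (f : A →ₙ+* B) (hf : Function.Surjective f) : coveringNumber A ≤ coveringNumber B := by
  refine le_iInf fun C => ?_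
  have hC : IsRingCover ((NonUnitalSubring.comap f) '' C.1) := by
    refine ⟨?_, fun r => ?_⟩
    · rintro _ ⟨S, hS, rfl⟩ htop
      refine C.2.1 S hS (eq_top_iff.2 fun b _ => ?_)
      obtain ⟨a, rfl⟩ := hf b
      have : a ∈ NonUnitalSubring.comap f S := htop ▸ NonUnitalSubring.mem_top a
      exact this
    · obtain ⟨S, hS, hr⟩ := C.2.2 (f r)
      exact ⟨_, ⟨S, hS, rfl⟩, hr⟩
  exact (iInf_le _ ⟨_, hC⟩).trans (Set.encard_image_le _ _)

/-- A ring generated by one element has no cover. -/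
theorem coveringNumber_eq_top_of_generator {R : Type*} [NonUnitalRing R] (u : R)
    (hu : ∀ S : NonUnitalSubring R, u ∈ S → S = ⊤) : coveringNumber R = ⊤ := by
  have : IsEmpty {C : Set (NonUnitalSubring R) // IsRingCover C} := by
    refine ⟨fun C => ?_⟩
    obtain ⟨S, hS, hr⟩ := C.2.2 u
    exact C.2.1 S hS (hu S hr)
  exact iInf_of_empty _

/-- If `n` elements generate the ring pairwise, every cover has at least `n` members. -/
theorem le_coveringNumber_of_pairwise {R : Type*} [NonUnitalRing R] {n : ℕ} (t : Fin n → R)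
    (ht : ∀ i j, i < j → ∀ S : NonUnitalSubring R, t i ∈ S → t j ∈ S → S = ⊤) :
    (n : ℕ∞) ≤ coveringNumber R := by
  refine le_iInf fun C => ?_
  choose S hS hr using fun i => C.2.2 (t i)
  have hinj : Function.Injective S := by
    intro i j hij
    by_contra hne
    rcases lt_or_gt_of_ne hne with h | h
    · exact C.2.1 _ (hS i) (ht i j h _ (hr i) (hij ▸ hr j))
    · exact C.2.1 _ (hS i) (ht j i h _ (hij ▸ hr j) (hr i))
  calc (n : ℕ∞) = (Set.range S).encard := by
        rw [← Set.image_univ, hinj.encard_image, Set.encard_univ]; simp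
    _ ≤ C.1.encard := Set.encard_le_encard (by rintro _ ⟨i, rfl⟩; exact hS i)

/-- The covering number of a quotient is infinite as soon as one element generates the ring
modulo the ideal. -/
theorem coveringNumber_quotient_eq_top {R : Type*} [Ring R] (I : TwoSidedIdeal R) (u : R)
    (hu : ∀ S : NonUnitalSubring R, (∀ r ∈ I, r ∈ S) → u ∈ S → S = ⊤) :
    coveringNumber I.ringCon.Quotient = ⊤ := by
  refine coveringNumber_eq_top_of_generator (I.ringCon.mk' u) fun S hS => ?_
  have key := hu (S.comap (I.ringCon.mk' : R →ₙ+* I.ringCon.Quotient)) (fun r hr => ?_) hS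
  · refine eq_top_iff.2 fun b _ => ?_
    obtain ⟨a, rfl⟩ := RingCon.mk'_surjective _ b
    have : a ∈ S.comap (I.ringCon.mk' : R →ₙ+* I.ringCon.Quotient) :=
      key ▸ NonUnitalSubring.mem_top a
    exact this
  · have h0 : I.ringCon.mk' r = 0 := by
      rw [← map_zero I.ringCon.mk']
      exact (RingCon.eq _).2 ((TwoSidedIdeal.mem_iff _ _).1 hr)
    show I.ringCon.mk' r ∈ S
    rw [h0]
    exact S.zero_mem

/-- A ring in `S(n)` is isomorphic to each of its homomorphic images of covering number at
most `n`. -/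
theorem MemS.nonempty_ringEquiv {R T : Type*} [Ring R] [Ring T] {n : ℕ} (hR : MemS n R)
    (f : R →+* T) (hf : Function.Surjective f) (hT : coveringNumber T ≤ n) :
    Nonempty (R ≃+* T) := by
  by_cases hk : TwoSidedIdeal.ker f = ⊥
  · exact ⟨RingEquiv.ofBijective f ⟨(TwoSidedIdeal.ker_eq_bot f).1 hk, hf⟩⟩
  · exfalso
    have hlt := hR.2 _ hk
    let g : (TwoSidedIdeal.ker f).ringCon.Quotient →+* T :=
      RingCon.lift _ f (fun x y h => h)
    have hg : Function.Surjective g := fun t => by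
      obtain ⟨r, rfl⟩ := hf t
      exact ⟨(TwoSidedIdeal.ker f).ringCon.mk' r, rfl⟩
    exact absurd ((coveringNumber_le_of_surjective (g : _ →ₙ+* T) hg).trans hT) (not_le.2 hlt)

theorem MemS.of_ringEquiv {R T : Type*} [Ring R] [Ring T] {n : ℕ} (e : R ≃+* T)
    (hT : MemS n T) : MemS n R := by
  refine ⟨le_antisymm ?_ ?_, fun I hI => ?_⟩
  · rw [← hT.1]
    exact coveringNumber_le_of_surjective (e : R →ₙ+* T) e.surjective
  · rw [← hT.1]
    exact coveringNumber_le_of_surjective (e.symm : T →ₙ+* R) e.symm.surjective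
  · have hJ : I.comap (e.symm : T →+* R) ≠ ⊥ := by
      intro h
      refine hI (eq_bot_iff.2 fun x hx => ?_)
      have hx' : e x ∈ I.comap (e.symm : T →+* R) := by
        rw [TwoSidedIdeal.mem_comap]; simpa using hx
      rw [h, TwoSidedIdeal.mem_bot] at hx'
      rw [TwoSidedIdeal.mem_bot]
      simpa using hx'
    refine (hT.2 _ hJ).trans_le ?_
    let g : (I.comap (e.symm : T →+* R)).ringCon.Quotient →+* I.ringCon.Quotient :=
      RingCon.lift _ (I.ringCon.mk'.comp (e.symm : T →+* R)) (fun x y h => (RingCon.eq _).2 h)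
    refine coveringNumber_le_of_surjective (g : _ →ₙ+* _) fun t => ?_
    obtain ⟨r, rfl⟩ := RingCon.mk'_surjective _ t
    exact ⟨RingCon.mk' _ (e r), by
      show I.ringCon.mk' (e.symm (e r)) = _
      simp⟩

/-! ### Irredundant covers of an abelian group by four subgroups. -/

namespace AddSubgroup

open scoped Pointwise

variable {G : Type*} [AddCommGroup G]

/-- A subgroup of prime index is maximal, by multiplicativity of the index. -/
theorem sup_eq_top_of_index_prime {K L : AddSubgroup G} (hK : K.index.Prime) (hL : ¬ L ≤ K) :
    L ⊔ K = ⊤ := by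
  have h := relIndex_mul_index (le_sup_right : K ≤ L ⊔ K)
  rcases (Nat.dvd_prime hK).1 (Dvd.intro_left _ h) with h1 | h1
  · exact index_eq_one.1 h1
  · rw [h1] at h
    have h2 : K.relIndex (L ⊔ K) = 1 := Nat.eq_of_mul_eq_mul_right hK.pos (by rw [h, one_mul])
    exact absurd (le_sup_left.trans (relIndex_eq_one.1 h2)) hL

/-- In a cover of an abelian group by four subgroups, the three members other than one of prime
index cover each nontrivial coset of that one. -/
theorem one_le_sum_inv_index_erase {H : Fin 4 → AddSubgroup G} (hcov : ∀ g, ∃ i, g ∈ H i)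
    {i : Fin 4} (hi : (H i).index.Prime) (hle : ∀ j, j ≠ i → ¬ H j ≤ H i)
    (hfin : ∀ j, (H j).index ≠ 0) (x : G) (hx : x ∉ H i) :
    1 ≤ ∑ j ∈ Finset.univ.erase i, ((H j).index : ℚ)⁻¹ ∧
      (∑ j ∈ Finset.univ.erase i, ((H j).index : ℚ)⁻¹ = 1 →
        ∀ j l, j ≠ i → l ≠ i → j ≠ l → x ∈ H j → x ∉ H l) := by
  classical
  have hsup : ∀ j, j ≠ i → H j ⊔ H i = ⊤ := fun j hj => sup_eq_top_of_index_prime hi (hle j hj)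
  -- Pulled back along `a ↦ x + a`, the set `H j` becomes a coset of `H j ∩ H i` in `H i`, with base
  -- point `k j`; its index in `H i` is that of `H j`, since `H j + H i` is everything.
  have hk : ∀ j, ∃ k : H i, j ≠ i → x + k ∈ H j := by
    intro j
    by_cases hj : j = i
    · exact ⟨0, fun h => absurd hj h⟩
    · have hxt : x ∈ H j ⊔ H i := hsup j hj ▸ mem_top x
      obtain ⟨a, ha, b, hb, rfl⟩ := mem_sup.1 hxt
      exact ⟨⟨-b, neg_mem hb⟩, fun _ => by simpa using ha⟩
  choose k hk using hk
  have hidx : ∀ j, j ≠ i → ((H j).addSubgroupOf (H i)).index = (H j).index := by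
    intro j hj
    have h1 : (H j).relIndex (H i ⊔ H j) = (H j).relIndex (H i) := relIndex_sup_right _ _
    rw [sup_comm, hsup j hj, relIndex_top_right] at h1
    exact h1.symm
  have hmem : ∀ j, j ≠ i → ∀ a : H i, x + a ∈ H j →
      a ∈ k j +ᵥ ((H j).addSubgroupOf (H i) : Set (H i)) := by
    intro j hj a ha
    rw [mem_leftAddCoset_iff]
    show -k j + a ∈ (H j).addSubgroupOf (H i)
    rw [mem_addSubgroupOf]
    have := sub_mem ha (hk j hj)
    rw [add_sub_add_left_eq_sub] at this
    simpa [add_comm, sub_eq_add_neg] using this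
  have hc : ⋃ j ∈ Finset.univ.erase i, k j +ᵥ ((H j).addSubgroupOf (H i) : Set (H i)) =
      Set.univ := by
    refine Set.eq_univ_iff_forall.2 fun a => ?_
    obtain ⟨j, hj⟩ := hcov (x + a)
    have hji : j ≠ i := by
      rintro rfl
      exact hx (by simpa using sub_mem hj a.2)
    exact Set.mem_iUnion₂.2 ⟨j, by simp [hji], hmem j hji a hj⟩
  have hsum : ∑ j ∈ Finset.univ.erase i, (((H j).addSubgroupOf (H i)).index : ℚ)⁻¹ =
      ∑ j ∈ Finset.univ.erase i, ((H j).index : ℚ)⁻¹ :=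
    Finset.sum_congr rfl fun j hj => by rw [hidx j (Finset.ne_of_mem_erase hj)]
  refine ⟨hsum ▸ one_le_sum_inv_index_of_leftCoset_cover hc, fun h1 j l hj hl hjl hxj hxl => ?_⟩
  have hdis := pairwiseDisjoint_leftCoset_cover_of_sum_neg_index_eq_zero hc (hsum.trans h1)
  have hjf : ∀ j, j ≠ i → j ∈ (Finset.univ.erase i).filter
      (fun j => ((H j).addSubgroupOf (H i)).FiniteIndex) := by
    intro j hj
    refine Finset.mem_filter.2 ⟨by simp [hj], ⟨?_⟩⟩
    rw [hidx j hj]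
    exact hfin j
  exact Set.disjoint_left.1 (hdis (hjf j hj) (hjf l hl) hjl)
    (hmem j hj 0 (by simpa using hxj)) (hmem l hl 0 (by simpa using hxl))

/-- If in an irredundant cover by four subgroups one has prime index and the others index at
least three, then these others have index three and meet pairwise inside the first. -/
theorem index_eq_three_of_cover {H : Fin 4 → AddSubgroup G} (hcov : ∀ g, ∃ i, g ∈ H i)
    {i : Fin 4} (hi : (H i).index.Prime) (hle : ∀ j, j ≠ i → ¬ H j ≤ H i)
    (h3 : ∀ j, j ≠ i → 3 ≤ (H j).index) :
    (∀ j, j ≠ i → (H j).index = 3) ∧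
      ∀ j l, j ≠ i → l ≠ i → j ≠ l → ∀ x, x ∈ H j → x ∈ H l → x ∈ H i := by
  have hfin : ∀ j, (H j).index ≠ 0 := by
    intro j
    by_cases hj : j = i
    · exact hj ▸ hi.ne_zero
    · have := h3 j hj; omega
  have hinv : ∀ j ∈ Finset.univ.erase i, ((H j).index : ℚ)⁻¹ ≤ 3⁻¹ := by
    intro j hj
    have : (3 : ℚ) ≤ (H j).index := by exact_mod_cast h3 j (Finset.ne_of_mem_erase hj)
    exact inv_anti₀ (by norm_num) this
  -- Three reciprocals of at most 1/3 sum to at most 1, and the coset inequality gives at least 1: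
  -- equality holds throughout.
  have hcst : ∑ _j ∈ Finset.univ.erase i, (3⁻¹ : ℚ) = 1 := by
    rw [Finset.sum_const, Finset.card_erase_of_mem (Finset.mem_univ _)]
    norm_num
  have hle1 : ∑ j ∈ Finset.univ.erase i, ((H j).index : ℚ)⁻¹ ≤ 1 :=
    hcst ▸ Finset.sum_le_sum hinv
  obtain ⟨x, hx⟩ : ∃ x, x ∉ H i := by
    by_contra! h
    have : H i = ⊤ := eq_top_iff.2 fun x _ => h x
    rw [this, index_top] at hi
    exact Nat.not_prime_one hi
  have hsum : ∑ j ∈ Finset.univ.erase i, ((H j).index : ℚ)⁻¹ = 1 :=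
    le_antisymm hle1 (one_le_sum_inv_index_erase hcov hi hle hfin x hx).1
  refine ⟨fun j hj => ?_, fun j l hj hl hjl x hxj hxl => ?_⟩
  · have := (Finset.sum_eq_sum_iff_of_le hinv).1 (hsum.trans hcst.symm) j (by simp [hj])
    have h' : ((H j).index : ℚ) = 3 := inv_injective this
    exact_mod_cast h'
  · by_contra hxi
    exact (one_le_sum_inv_index_erase hcov hi hle hfin x hxi).2 hsum j l hj hl hjl hxj hxl

/-- An irredundant cover of an abelian group by four subgroups either has two members of index
two, or consists of subgroups of index three with a common pairwise intersection. -/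
theorem irredundant_cover_four {H : Fin 4 → AddSubgroup G} (hcov : ∀ g, ∃ i, g ∈ H i)
    (hirr : ∀ i, ∃ x, ∀ j, j ≠ i → x ∉ H j) :
    (∃ i j, i ≠ j ∧ (H i).index = 2 ∧ (H j).index = 2) ∨
      ((∀ i, (H i).index = 3) ∧
        ∀ i j l, j ≠ i → l ≠ i → j ≠ l → ∀ x, x ∈ H j → x ∈ H l → x ∈ H i) := by
  classical
  have hle : ∀ i j, j ≠ i → ¬ H j ≤ H i := by
    intro i j hj h
    obtain ⟨x, hx⟩ := hirr j
    obtain ⟨l, hl⟩ := hcov x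
    have : l = j := by
      by_contra hlj
      exact hx l hlj hl
    subst this
    exact hx i (Ne.symm hj) (h hl)
  have hc : ⋃ j ∈ Finset.univ, (0 : G) +ᵥ (H j : Set G) = Set.univ := by
    refine Set.eq_univ_iff_forall.2 fun a => ?_
    obtain ⟨j, hj⟩ := hcov a
    exact Set.mem_iUnion₂.2 ⟨j, by simp, by simpa using hj⟩
  -- By Neumann's lemma the members of finite index already cover, so irredundancy leaves no others.
  have hfin : ∀ i, (H i).FiniteIndex := by
    intro i
    have hf := leftCoset_cover_filter_FiniteIndex hc
    obtain ⟨x, hx⟩ := hirr i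
    have hxu : x ∈ ⋃ k ∈ Finset.univ.filter (fun i => (H i).FiniteIndex),
        (0 : G) +ᵥ (H k : Set G) := hf ▸ Set.mem_univ x
    obtain ⟨j, hj, hxj⟩ := Set.mem_iUnion₂.1 hxu
    have hxj' : x ∈ H j := by simpa using hxj
    have : j = i := by
      by_contra hji
      exact hx j hji hxj'
    exact this ▸ (Finset.mem_filter.1 hj).2
  have hge : ∀ i, 2 ≤ (H i).index := by
    intro i
    have h0 := (hfin i).index_ne_zero
    have h1 : (H i).index ≠ 1 := by
      intro h
      rw [index_eq_one] at h
      obtain ⟨j, hj⟩ : ∃ j : Fin 4, j ≠ i := exists_ne i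
      obtain ⟨x, hx⟩ := hirr j
      exact hx i hj.symm (h ▸ mem_top x)
    omega
  -- If all indices were at least 4, the reciprocals would sum to exactly 1 and the members would be
  -- disjoint, yet all contain 0.
  have hsmall : ∃ i, (H i).index ≤ 3 := by
    by_contra! h
    have hinv : ∀ j ∈ Finset.univ, ((H j).index : ℚ)⁻¹ ≤ 4⁻¹ := by
      intro j _
      have : (4 : ℚ) ≤ (H j).index := by exact_mod_cast h j
      exact inv_anti₀ (by norm_num) this
    have hs : ∑ j, ((H j).index : ℚ)⁻¹ = 1 := by
      refine le_antisymm ((Finset.sum_le_sum hinv).trans (by norm_num))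
        (one_le_sum_inv_index_of_leftCoset_cover hc)
    have hd := pairwiseDisjoint_leftCoset_cover_of_sum_neg_index_eq_zero hc hs
    have hm : ∀ j : Fin 4, j ∈ Finset.univ.filter (fun i => (H i).FiniteIndex) :=
      fun j => Finset.mem_filter.2 ⟨Finset.mem_univ _, hfin j⟩
    exact Set.disjoint_left.1 (hd (hm 0) (hm 1) (by decide))
      (show (0 : G) ∈ (0 : G) +ᵥ (H 0 : Set G) by simp)
      (show (0 : G) ∈ (0 : G) +ᵥ (H 1 : Set G) by simp)
  by_cases htwo : ∃ i, (H i).index = 2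
  · obtain ⟨i, hi⟩ := htwo
    left
    by_contra! hno
    have h3 : ∀ j, j ≠ i → 3 ≤ (H j).index := by
      intro j hj
      have := hge j
      have := hno i j hj.symm hi
      omega
    obtain ⟨he, hin⟩ := index_eq_three_of_cover hcov (hi ▸ Nat.prime_two) (hle i) h3
    -- A single member of index 2 is impossible: for `y` in `H j` but not in `H i`, `3y` lies in `H
    -- j ∩ H l ≤ H i` and `2y` lies in `H i`, hence so does `y`.
    obtain ⟨j, l, hj, hl, hjl⟩ : ∃ j l : Fin 4, j ≠ i ∧ l ≠ i ∧ j ≠ l := by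
      clear hi hle h3 he hin
      revert i; decide
    obtain ⟨y, hyj, hyi⟩ := SetLike.not_le_iff_exists.1 (hle i j hj)
    have h3y : 3 • y ∈ H i := by
      refine hin j l hj hl hjl _ (nsmul_mem hyj 3) ?_
      rw [← he l hl]
      exact nsmul_index_mem _ _
    have h2y : 2 • y ∈ H i := by
      rw [← hi]
      exact nsmul_index_mem _ _
    refine hyi ?_
    have := sub_mem h3y h2y
    simpa [succ_nsmul] using this
  · right
    have h3 : ∀ j, 3 ≤ (H j).index := by
      intro j
      have := hge j
      have : (H j).index ≠ 2 := fun h => htwo ⟨j, h⟩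
      omega
    obtain ⟨i, hi⟩ := hsmall
    have hi3 : (H i).index = 3 := le_antisymm hi (h3 i)
    have hall : ∀ j, (H j).index = 3 := by
      intro j
      by_cases hj : j = i
      · exact hj ▸ hi3
      · exact (index_eq_three_of_cover hcov (hi3 ▸ Nat.prime_three) (hle i) fun j _ => h3 j).1 j hj
    exact ⟨hall, fun i => (index_eq_three_of_cover hcov ((hall i).symm ▸ Nat.prime_three)
      (hle i) fun j _ => h3 j).2⟩

end AddSubgroup

/-! ### Derivations over a pair of characters. -/

section Skew

variable {R : Type*} [Ring R] {p : ℕ}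

/-- `f` is a derivation with respect to the left action through `l` and the right action
through `m`. -/
def IsSkewDerivation (l m : R →+* ZMod p) (f : R →+ ZMod p) : Prop :=
  ∀ r s, f (r * s) = f r * m s + l r * f s

/-- An additive map whose kernel is closed under multiplication cuts out a subring. -/
def kerSubring (f : R →+ ZMod p) (hf : ∀ r s, f r = 0 → f s = 0 → f (r * s) = 0) :
    NonUnitalSubring R where
  carrier := {r | f r = 0}
  zero_mem' := map_zero f
  add_mem' := by
    intro a b ha hb
    show f (a + b) = 0
    rw [map_add, show f a = 0 from ha, show f b = 0 from hb, add_zero]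
  neg_mem' := by
    intro a ha
    show f (-a) = 0
    rw [map_neg, show f a = 0 from ha, neg_zero]
  mul_mem' := fun {a b} ha hb => hf a b ha hb

theorem mem_kerSubring {f : R →+ ZMod p} {hf : ∀ r s, f r = 0 → f s = 0 → f (r * s) = 0} {r : R} :
    r ∈ kerSubring f hf ↔ f r = 0 := Iff.rfl

theorem kerSubring_ne_top {f : R →+ ZMod p} {hf : ∀ r s, f r = 0 → f s = 0 → f (r * s) = 0}
    {r : R} (hr : f r ≠ 0) : kerSubring f hf ≠ ⊤ := fun h =>
  hr (mem_kerSubring.1 (h ▸ NonUnitalSubring.mem_top r : r ∈ kerSubring f hf))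

namespace IsSkewDerivation

variable {l m : R →+* ZMod p} {f g : R →+ ZMod p}

theorem ker_mul (hf : IsSkewDerivation l m f) (r s : R) (hr : f r = 0) (hs : f s = 0) :
    f (r * s) = 0 := by
  rw [hf, hr, hs, zero_mul, mul_zero, add_zero]

theorem add (hf : IsSkewDerivation l m f) (hg : IsSkewDerivation l m g) :
    IsSkewDerivation l m (f + g) := by
  intro r s
  simp only [AddMonoidHom.add_apply]
  rw [hf, hg]
  ring

theorem sub (hf : IsSkewDerivation l m f) (hg : IsSkewDerivation l m g) :
    IsSkewDerivation l m (f - g) := by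
  intro r s
  simp only [AddMonoidHom.sub_apply]
  rw [hf, hg]
  ring

theorem mulLeft_comp (hf : IsSkewDerivation l m f) (c : ZMod p) :
    IsSkewDerivation l m ((AddMonoidHom.mulLeft c).comp f) := by
  intro r s
  simp only [AddMonoidHom.comp_apply, AddMonoidHom.coe_mulLeft]
  rw [hf]
  ring

theorem map_one (hf : IsSkewDerivation l m f) : f 1 = 0 := by
  have h := hf 1 1
  rw [mul_one, l.map_one, m.map_one] at h
  linear_combination -h

/-- The difference of two characters is a derivation. -/
theorem sub_characters (l m : R →+* ZMod p) :
    IsSkewDerivation l m ((l : R →+ ZMod p) - (m : R →+ ZMod p)) := by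
  intro r s
  simp only [AddMonoidHom.sub_apply, AddMonoidHom.coe_coe, map_mul]
  ring

end IsSkewDerivation

/-- The homomorphism to upper triangular matrices given by a derivation. -/
def upperTriangularHom (l m : R →+* ZMod p) (f : R →+ ZMod p) (hf : IsSkewDerivation l m f) :
    R →+* upperTriangular (ZMod p) where
  toFun r := ⟨!![l r, f r; 0, m r], show (!![l r, f r; 0, m r] : Matrix (Fin 2) (Fin 2) (ZMod p)) 1 0 = 0 by simp⟩
  map_one' := by
    ext i j
    fin_cases i <;> fin_cases j <;> simp [hf.map_one]
  map_zero' := by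
    ext i j
    fin_cases i <;> fin_cases j <;> simp
  map_add' r s := by
    ext i j
    fin_cases i <;> fin_cases j <;> simp
  map_mul' r s := by
    ext i j
    fin_cases i <;> fin_cases j <;> simp [hf r s]
    ring

/-- `R` need not be a `ZMod p`-module, so scalars act through their natural representatives `c.val`.
-/
theorem map_val_nsmul [NeZero p] (f : R →+ ZMod p) (c : ZMod p) (x : R) :
    f (c.val • x) = c * f x := by
  rw [map_nsmul, nsmul_eq_mul, ZMod.natCast_zmod_val]

/-- Bilinear expansion of `f (r * s)` when the kernel of `f` is a subring. -/
theorem map_mul_of_ker_mul [NeZero p] (f : R →+ ZMod p)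
    (hf : ∀ r s, f r = 0 → f s = 0 → f (r * s) = 0)
    {x : R} (hx : f x = 1) (r s : R) :
    f (r * s) = f r * f (x * s) + f (r * x) * f s - f r * f s * f (x * x) := by
  have h0 : ∀ r, f (r - (f r).val • x) = 0 := by
    intro r
    rw [map_sub, map_val_nsmul, hx, mul_one, sub_self]
  have h := hf _ _ (h0 r) (h0 s)
  simp only [sub_mul, mul_sub, smul_mul_assoc, mul_smul_comm, map_sub, map_val_nsmul] at h
  linear_combination h

end Skew

/-! ### Four kernels over `ZMod 3`. -/

section Three

variable {R : Type*} [Ring R]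

/-- Two independent derivations into `ZMod 3` give a cover by four subrings. -/
theorem coveringNumber_le_four_of_derivations {l m : R →+* ZMod 3} {f g : R →+ ZMod 3}
    (hf : IsSkewDerivation l m f) (hg : IsSkewDerivation l m g) {x y : R}
    (hfx : f x = 1) (hgx : g x = 0) (hgy : g y = 1) :
    coveringNumber R ≤ 4 := by
  refine coveringNumber_le_of_family ![kerSubring f hf.ker_mul, kerSubring g hg.ker_mul,
    kerSubring _ (hf.add hg).ker_mul, kerSubring _ (hf.sub hg).ker_mul] ?_ ?_
  · intro i
    fin_cases i
    · exact kerSubring_ne_top (r := x) (by rw [hfx]; decide)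
    · exact kerSubring_ne_top (r := y) (by rw [hgy]; decide)
    · exact kerSubring_ne_top (r := x) (by rw [AddMonoidHom.add_apply, hfx, hgx]; decide)
    · exact kerSubring_ne_top (r := x) (by rw [AddMonoidHom.sub_apply, hfx, hgx]; decide)
  · intro r
    have key : ∀ a b : ZMod 3, a = 0 ∨ b = 0 ∨ a + b = 0 ∨ a - b = 0 := by decide
    rcases key (f r) (g r) with h | h | h | h
    · exact ⟨0, h⟩
    · exact ⟨1, h⟩
    · exact ⟨2, h⟩
    · exact ⟨3, h⟩

/-- If the kernels of `f`, `g`, `f + g` and `f - g` are subrings, then `f` and `g` are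
derivations with respect to a common pair of characters. -/
theorem exists_characters_of_ker_mul (f g : R →+ ZMod 3) {x y : R}
    (hfx : f x = 1) (hgx : g x = 0) (hfy : f y = 0) (hgy : g y = 1)
    (hf : ∀ r s, f r = 0 → f s = 0 → f (r * s) = 0)
    (hg : ∀ r s, g r = 0 → g s = 0 → g (r * s) = 0)
    (hadd : ∀ r s, (f + g) r = 0 → (f + g) s = 0 → (f + g) (r * s) = 0)
    (hsub : ∀ r s, (f - g) r = 0 → (f - g) s = 0 → (f - g) (r * s) = 0) :
    ∃ l m : R →+* ZMod 3, IsSkewDerivation l m f ∧ IsSkewDerivation l m g := by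
  have h3 : (3 : ZMod 3) = 0 := by decide
  have hfyy := hf y y hfy hfy
  have hgxx := hg x x hgx hgx
  have hplus := hsub (x + y) (x + y) (by simp [hfx, hgx, hfy, hgy]) (by simp [hfx, hgx, hfy, hgy])
  have hminus := hadd (x - y) (x - y) (by simp [hfx, hgx, hfy, hgy])
    (by simp [hfx, hgx, hfy, hgy])
  simp only [AddMonoidHom.sub_apply, AddMonoidHom.add_apply, add_mul, mul_add, sub_mul, mul_sub,
    map_add, map_sub, hfyy, hgxx] at hplus hminus
  -- The factor 2 in the combination is the inverse of 2 modulo 3.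
  have hfxx : f (x * x) = g (x * y) + g (y * x) := by
    linear_combination 2 * (hplus + hminus) - (f (x * x) - g (x * y) - g (y * x)) * h3
  have hgyy : g (y * y) = f (x * y) + f (y * x) := by
    linear_combination 2 * (hminus - hplus) - (g (y * y) - f (x * y) - f (y * x)) * h3
  have hdec : ∀ r, ∃ d, f d = 0 ∧ g d = 0 ∧ r = d + (f r).val • x + (g r).val • y := by
    intro r
    refine ⟨r - (f r).val • x - (g r).val • y, ?_, ?_, by abel⟩ <;>
    simp only [map_sub, map_val_nsmul, hfx, hgx, hfy, hgy] <;> ring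
  have hxy0 : (f - g) (x + y) = 0 := by simp [hfx, hgx, hfy, hgy]
  -- For `d` killed by `f` and `g`, `(x + y) * d` lies in the kernel of `f - g` while `f (y * d) = g
  -- (x * d) = 0`, so `f (x * d) = g (y * d)`. This makes the characters read off from `f` and from
  -- `g` agree.
  have hgy_mul : ∀ s, g (y * s) = f (x * s) - f s * g (x * y) + g s * (g (y * y) - f (x * y)) := by
    intro s
    obtain ⟨d, hfd, hgd, hs⟩ := hdec s
    have h := hsub (x + y) d hxy0 (by simp [hfd, hgd])
    simp only [AddMonoidHom.sub_apply, add_mul, map_add, hf y d hfy hfd, hg x d hgx hgd] at h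
    have e1 : g (y * s) = g (y * d) + f s * g (y * x) + g s * g (y * y) := by
      conv_lhs => rw [hs]
      simp only [mul_add, mul_smul_comm, map_add, map_val_nsmul]
    have e2 : f (x * s) = f (x * d) + f s * f (x * x) + g s * f (x * y) := by
      conv_lhs => rw [hs]
      simp only [mul_add, mul_smul_comm, map_add, map_val_nsmul]
    linear_combination e1 - e2 - h - f s * hfxx
  have hmul_gy : ∀ r, g (r * y) = f (r * x) - f r * g (y * x) + g r * (g (y * y) - f (y * x)) := by
    intro s
    obtain ⟨d, hfd, hgd, hs⟩ := hdec s
    have h := hsub d (x + y) (by simp [hfd, hgd]) hxy0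
    simp only [AddMonoidHom.sub_apply, mul_add, map_add, hf d y hfd hfy, hg d x hgd hgx] at h
    have e1 : g (s * y) = g (d * y) + f s * g (x * y) + g s * g (y * y) := by
      conv_lhs => rw [hs]
      simp only [add_mul, smul_mul_assoc, map_add, map_val_nsmul]
    have e2 : f (s * x) = f (d * x) + f s * f (x * x) + g s * f (y * x) := by
      conv_lhs => rw [hs]
      simp only [add_mul, smul_mul_assoc, map_add, map_val_nsmul]
    linear_combination e1 - e2 - h - f s * hfxx
  -- The required characters are determined: `g (x * y)` must be `l x` and `g (y * x)` must be `m
  -- x`, so evaluating `f (x * s)` and `f (r * x)` leaves `A` for `m` and `B` for `l`.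
  let A : R → ZMod 3 := fun s => f (x * s) - f s * g (x * y)
  let B : R → ZMod 3 := fun r => f (r * x) - f r * g (y * x)
  have hfm : ∀ r s, f (r * s) = f r * A s + B r * f s := by
    intro r s
    have h := map_mul_of_ker_mul f hf hfx r s
    simp only [A, B]
    linear_combination h - f r * f s * hfxx
  have hgm : ∀ r s, g (r * s) = g r * A s + B r * g s := by
    intro r s
    have h := map_mul_of_ker_mul g hg hgy r s
    simp only [A, B]
    linear_combination h + g r * hgy_mul s + g s * hmul_gy r + g r * g s * hgyy
  have hAadd : ∀ r s, A (r + s) = A r + A s := by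
    intro r s
    simp only [A, mul_add, map_add]
    ring
  have hBadd : ∀ r s, B (r + s) = B r + B s := by
    intro r s
    simp only [B, add_mul, map_add]
    ring
  -- Associativity: expand `f` of `(r * s) * x` and of `r * (s * x)` by `hfm`.
  have hBf : ∀ r s, f r = 0 → B (r * s) = B r * B s := by
    intro r s hr
    have h1 := hfm (r * s) x
    rw [mul_assoc, hfm r (s * x), hfm s x, hfm r s, hr, hfx] at h1
    linear_combination -h1
  have hBg : ∀ r s, g r = 0 → B (r * s) = B r * B s := by
    intro r s hr
    have h1 := hgm (r * s) y
    rw [mul_assoc, hgm r (s * y), hgm s y, hgm r s, hr, hgy] at h1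
    linear_combination -h1
  have hAf : ∀ s t, f t = 0 → A (s * t) = A s * A t := by
    intro s t ht
    have h1 := hfm x (s * t)
    rw [← mul_assoc, hfm (x * s) t, hfm x s, hfm s t, ht, hfx] at h1
    linear_combination -h1
  have hAg : ∀ s t, g t = 0 → A (s * t) = A s * A t := by
    intro s t ht
    have h1 := hgm y (s * t)
    rw [← mul_assoc, hgm (y * s) t, hgm y s, hgm s t, ht, hgy] at h1
    linear_combination -h1
  -- The two kernels together span `R`, so multiplicativity on each one suffices by additivity.
  have hsplit : ∀ r, ∃ u v, f u = 0 ∧ g v = 0 ∧ r = u + v := by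
    intro r
    refine ⟨r - (f r).val • x, (f r).val • x, ?_, ?_, by abel⟩ <;>
    simp only [map_sub, map_val_nsmul, hfx, hgx] <;> ring
  have hBmul : ∀ r s, B (r * s) = B r * B s := by
    intro r s
    obtain ⟨u, v, hu, hv, rfl⟩ := hsplit r
    rw [add_mul, hBadd, hBadd, hBf u s hu, hBg v s hv]
    ring
  have hAmul : ∀ r s, A (r * s) = A r * A s := by
    intro r s
    obtain ⟨u, v, hu, hv, rfl⟩ := hsplit s
    rw [mul_add, hAadd, hAadd, hAf r u hu, hAg r v hv]
    ring
  -- If `f 1 ≠ 0`, multiplying `y` by 1 on either side forces `A 1 = 0` and `B y = 0`, whence `g (y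
  -- * 1) = 0`, against `g y = 1`.
  have hf1 : f 1 = 0 := by
    by_contra hne
    have hAy : A y = 0 := by
      have := hfm 1 y
      rw [one_mul, hfy, mul_zero, add_zero] at this
      exact (mul_eq_zero.1 this.symm).resolve_left hne
    have hB1 : B 1 = 1 := by
      have := hgm 1 y
      rw [one_mul, hgy, hAy] at this
      linear_combination -this
    have hA1 : A 1 = 0 := by
      have := hfm 1 1
      rw [one_mul, hB1] at this
      have h' : f 1 * A 1 = 0 := by linear_combination -this
      exact (mul_eq_zero.1 h').resolve_left hne
    have hBy : B y = 0 := by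
      have := hfm y 1
      rw [mul_one, hfy, zero_mul, zero_add] at this
      exact (mul_eq_zero.1 this.symm).resolve_right hne
    have := hgm y 1
    rw [mul_one, hgy, hA1, hBy] at this
    simp at this
  have hA1 : A 1 = 1 := by
    have := hfm x 1
    rw [mul_one, hfx, hf1] at this
    linear_combination -this
  have hB1 : B 1 = 1 := by
    have := hfm 1 x
    rw [one_mul, hfx, hf1] at this
    linear_combination -this
  refine ⟨RingHom.mk' ⟨⟨B, hB1⟩, hBmul⟩ hBadd, RingHom.mk' ⟨⟨A, hA1⟩, hAmul⟩ hAadd,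
    hfm, hgm⟩

end Three

/-! ### Two criteria for membership in `S(4)` over `F₃`. -/

section LocalRing

variable {T : Type*} [Ring T]

/-- A ring with a character to `ZMod 3` and two derivations along it that are jointly injective
and have a dual basis in the kernel of the character belongs to `S(4)`. -/
theorem memS_four_of_two_derivations (l : T →+* ZMod 3) (f g : T →+ ZMod 3)
    (hf : IsSkewDerivation l l f) (hg : IsSkewDerivation l l g)
    (hinj : ∀ r s, l r = l s → f r = f s → g r = g s → r = s) {x y : T}
    (hlx : l x = 0) (hfx : f x = 1) (hgx : g x = 0)
    (hly : l y = 0) (hfy : f y = 0) (hgy : g y = 1) : MemS 4 T := by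
  have hnil : ∀ u, l u = 0 → u * u = 0 := fun u hu =>
    hinj _ _ (by simp [hu]) (by rw [hf]; simp [hu]) (by rw [hg]; simp [hu])
  have htop : ∀ S : NonUnitalSubring T, 1 ∈ S → x ∈ S → y ∈ S → S = ⊤ := by
    refine fun S h1 hx hy => eq_top_iff.2 fun r _ => ?_
    have hr : r = (l r).val • 1 + (f r).val • x + (g r).val • y := by
      refine hinj _ _ ?_ ?_ ?_
      · have := fun c z => map_val_nsmul (l : T →+ ZMod 3) c z
        simp only [AddMonoidHom.coe_coe] at this
        simp only [map_add, this, map_one, hlx, hly]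
        ring
      · simp only [map_add, map_val_nsmul, hf.map_one, hfx, hfy]
        ring
      · simp only [map_add, map_val_nsmul, hg.map_one, hgx, hgy]
        ring
    rw [hr]
    exact add_mem (add_mem (nsmul_mem h1 _) (nsmul_mem hx _)) (nsmul_mem hy _)
  have hone : ∀ S : NonUnitalSubring T, ∀ u, l u = 0 → 1 + u ∈ S → 1 ∈ S ∧ u ∈ S := by
    intro S u hu h
    have h1 : (1 : T) ∈ S := by
      have : (1 : T) = (1 + u) + (1 + u) - (1 + u) * (1 + u) := by
        rw [mul_add, add_mul, add_mul, hnil u hu]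
        noncomm_ring
      rw [this]
      exact sub_mem (add_mem h h) (mul_mem h h)
    exact ⟨h1, by simpa using sub_mem h h1⟩
  have h3 : ∀ u : T, u + u + u = 0 := by
    have key : ∀ a : ZMod 3, a + a + a = 0 := by decide
    exact fun u => hinj _ _ (by simp [key]) (by simp [key]) (by simp [key])
  have hdbl : ∀ S : NonUnitalSubring T, ∀ u, u + u ∈ S → u ∈ S := by
    intro S u h
    have : u = -(u + u) := by
      rw [eq_neg_iff_add_eq_zero, ← add_assoc]
      exact h3 u
    rw [this]
    exact neg_mem h
  have hlxy : l (x + y) = 0 := by simp [hlx, hly]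
  have hlxy' : l (x - y) = 0 := by simp [hlx, hly]
  refine ⟨le_antisymm (coveringNumber_le_four_of_derivations hf hg hfx hgx hgy) ?_, ?_⟩
  -- One element `1 + u` for each of the four lines in the plane spanned by `x`, `y`; since `u² =
  -- 0`, it generates both `1` and `u`.
  · refine le_coveringNumber_of_pairwise ![1 + x, 1 + y, 1 + (x + y), 1 + (x - y)] ?_
    intro i j hij S hi hj
    fin_cases i <;> fin_cases j <;> first | exact absurd hij (by decide) | skip
    · exact htop S (hone S x hlx hi).1 (hone S x hlx hi).2 (hone S y hly hj).2
    · have hx := (hone S x hlx hi).2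
      have hxy := (hone S _ hlxy hj).2
      exact htop S (hone S x hlx hi).1 hx (by simpa using sub_mem hxy hx)
    · have hx := (hone S x hlx hi).2
      have hxy := (hone S _ hlxy' hj).2
      exact htop S (hone S x hlx hi).1 hx (by simpa using sub_mem hx hxy)
    · have hy := (hone S y hly hi).2
      have hxy := (hone S _ hlxy hj).2
      exact htop S (hone S y hly hi).1 (by simpa using sub_mem hxy hy) hy
    · have hy := (hone S y hly hi).2
      have hxy := (hone S _ hlxy' hj).2
      exact htop S (hone S y hly hi).1 (by simpa using add_mem hxy hy) hy
    · have hp := (hone S _ hlxy hi).2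
      have hm := (hone S _ hlxy' hj).2
      refine htop S (hone S _ hlxy hi).1 (hdbl S x ?_) (hdbl S y ?_)
      · have := add_mem hp hm
        rwa [show x + y + (x - y) = x + x by abel] at this
      · have := sub_mem hp hm
        rwa [show x + y - (x - y) = y + y by abel] at this
  · intro I hI
    obtain ⟨n, hnI, hn0⟩ : ∃ n ∈ I, n ≠ 0 := by
      by_contra! h
      exact hI (eq_bot_iff.2 fun r hr => (TwoSidedIdeal.mem_bot T).2 (h r hr))
    have hz3 : ∀ a : ZMod 3, a ≠ 0 → a = 1 ∨ a = -1 := by decide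
    have hsgn : ∀ S : NonUnitalSubring T, ∀ u, -u ∈ S → u ∈ S := fun S u h => by
      simpa using neg_mem h
    suffices h : ∃ u : T, ∀ S : NonUnitalSubring T, (∀ r ∈ I, r ∈ S) → u ∈ S → S = ⊤ by
      obtain ⟨u, hu⟩ := h
      rw [coveringNumber_quotient_eq_top I u hu]
      exact ENat.natCast_lt_top 4
    by_cases hln : l n = 0
    · by_cases hfn : f n = 0
      · have hgn : g n ≠ 0 := fun hgn =>
          hn0 (hinj _ _ (by simp [hln]) (by simp [hfn]) (by simp [hgn]))
        refine ⟨1 + x, fun S hS hu => ?_⟩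
        obtain ⟨h1, hx⟩ := hone S x hlx hu
        refine htop S h1 hx ?_
        rcases hz3 _ hgn with h | h
        · rw [show y = n from hinj _ _ (by rw [hly, hln]) (by rw [hfy, hfn]) (by rw [hgy, h])]
          exact hS n hnI
        · refine hsgn S y ?_
          rw [show -y = n from hinj _ _ (by rw [map_neg, hly, hln, neg_zero])
            (by rw [map_neg, hfy, hfn, neg_zero]) (by rw [map_neg, hgy, h])]
          exact hS n hnI
      · refine ⟨1 + y, fun S hS hu => ?_⟩
        obtain ⟨h1, hy⟩ := hone S y hly hu
        refine htop S h1 ?_ hy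
        have hxn : n - (g n).val • y ∈ S := sub_mem (hS n hnI) (nsmul_mem hy _)
        rcases hz3 _ hfn with h | h
        · rw [show x = n - (g n).val • y from hinj _ _ (by simp [hlx, hly, hln])
            (by rw [map_sub, map_val_nsmul, hfx, hfy, h]; ring)
            (by rw [map_sub, map_val_nsmul, hgx, hgy]; ring)]
          exact hxn
        · refine hsgn S x ?_
          rw [show -x = n - (g n).val • y from hinj _ _ (by simp [hlx, hly, hln])
            (by rw [map_sub, map_val_nsmul, map_neg, hfx, hfy, h]; ring)
            (by rw [map_sub, map_val_nsmul, map_neg, hgx, hgy]; ring)]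
          exact hxn
    · refine ⟨0, fun S hS _ => ?_⟩
      have hsq : ∀ a : ZMod 3, a ≠ 0 → a * a = 1 := by decide
      have h1I : (1 : T) ∈ I := by
        -- `n²` is 1 plus an element of square zero, and cubing such an element in characteristic 3
        -- gives 1; so `n` is a unit.
        have hcube : (n * n) * ((n * n) * (n * n)) = 1 := by
          have hnn : l (n * n - 1) = 0 := by rw [map_sub, map_mul, hsq _ hln, map_one, sub_self]
          have h0 := hnil _ hnn
          have hN : ∀ N : T, (N - 1) * (N - 1) = 0 → N * (N * N) = 1 := by
            intro N hN
            have e1 : N * N = N + N - 1 := by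
              rw [← sub_eq_zero]
              rw [← hN]
              noncomm_ring
            have e2 : N * (N * N) = (N + N + N) - 1 - 1 := by
              rw [e1, mul_sub, mul_add, e1]
              noncomm_ring
            rw [e2, h3, zero_sub, ← sub_eq_zero, ← neg_eq_zero]
            rw [← h3 1]
            abel
          exact hN _ h0
        rw [← hcube]
        exact I.mul_mem_right _ _ (I.mul_mem_right _ _ hnI)
      have hall : ∀ r, r ∈ S := fun r => hS r (by simpa using I.mul_mem_left r 1 h1I)
      exact eq_top_iff.2 fun r _ => hall r

/-- A ring with two characters to `ZMod 3` and a derivation that are jointly bijective belongs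
to `S(4)`. -/
theorem memS_four_of_triangular (l m : T →+* ZMod 3) (f : T →+ ZMod 3)
    (hf : IsSkewDerivation l m f)
    (hinj : ∀ r s, l r = l s → m r = m s → f r = f s → r = s) {d n : T}
    (hld : l d = 1) (hmd : m d = -1) (hfd : f d = 0)
    (hln : l n = 0) (hmn : m n = 0) (hfn : f n = 1) : MemS 4 T := by
  -- Coordinates of `(a, b)` in the basis `(1, 1)`, `(1, -1)`, using `1/2 = -1` modulo 3.
  have hz3 : ∀ a b : ZMod 3, a = (-(a + b)) * 1 + (b - a) * 1 ∧
      b = (-(a + b)) * 1 + (b - a) * (-1) := by decide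
  have htop : ∀ S : NonUnitalSubring T, 1 ∈ S → d ∈ S → n ∈ S → S = ⊤ := by
    refine fun S h1 hd hn => eq_top_iff.2 fun r _ => ?_
    have hl := fun c z => map_val_nsmul (l : T →+ ZMod 3) c z
    have hm := fun c z => map_val_nsmul (m : T →+ ZMod 3) c z
    simp only [AddMonoidHom.coe_coe] at hl hm
    have hr : r = (-(l r + m r)).val • 1 + (m r - l r).val • d + (f r).val • n := by
      refine hinj _ _ ?_ ?_ ?_
      · simp only [map_add, hl, map_one, hld, hln, mul_zero, add_zero]
        exact (hz3 _ _).1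
      · simp only [map_add, hm, map_one, hmd, hmn, mul_zero, add_zero]
        exact (hz3 _ _).2
      · simp only [map_add, map_val_nsmul, hf.map_one, hfd, hfn]
        ring
    rw [hr]
    exact add_mem (add_mem (nsmul_mem h1 _) (nsmul_mem hd _)) (nsmul_mem hn _)
  have h3 : ∀ u : T, u + u + u = 0 := by
    have key : ∀ a : ZMod 3, a + a + a = 0 := by decide
    exact fun u => hinj _ _ (by simp [key]) (by simp [key]) (by simp [key])
  have hnn : n * n = 0 := hinj _ _ (by simp [hln]) (by simp [hmn]) (by rw [hf]; simp [hln, hmn])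
  have hdn : d * n + n * d = 0 := hinj _ _ (by simp [hln]) (by simp [hmn])
    (by simp [hf d n, hf n d, hld, hmd, hfd, hln, hmn, hfn])
  have hdd : d * d = 1 := hinj _ _ (by simp [hld]) (by simp [hmd])
    (by simp [hf d d, hfd, hf.map_one])
  have hsq1 : (d + n) * (d + n) = 1 := by
    rw [add_mul, mul_add, mul_add, hdd, hnn, add_zero, add_assoc, hdn, add_zero]
  have hsq2 : (d - n) * (d - n) = 1 := by
    rw [sub_mul, mul_sub, mul_sub, hdd, hnn, sub_zero, sub_sub, hdn, sub_zero]
  have hone : ∀ S : NonUnitalSubring T, ∀ u, u * u = 1 → u ∈ S → 1 ∈ S :=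
    fun S u hu h => hu ▸ mul_mem h h
  have huni : ∀ S : NonUnitalSubring T, 1 + n ∈ S → 1 ∈ S ∧ n ∈ S := by
    intro S h
    have h1 : (1 : T) ∈ S := by
      have : (1 : T) = (1 + n) + (1 + n) - (1 + n) * (1 + n) := by
        rw [mul_add, add_mul, add_mul, hnn]
        noncomm_ring
      rw [this]
      exact sub_mem (add_mem h h) (mul_mem h h)
    exact ⟨h1, by simpa using sub_mem h h1⟩
  have hdbl : ∀ S : NonUnitalSubring T, ∀ u, u + u ∈ S → u ∈ S := by
    intro S u h
    have : u = -(u + u) := by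
      rw [eq_neg_iff_add_eq_zero, ← add_assoc]
      exact h3 u
    rw [this]
    exact neg_mem h
  refine ⟨le_antisymm ?_ ?_, ?_⟩
  -- The second derivation is `l - m`; its value at `-d` is `-2 = 1`.
  · refine coveringNumber_le_four_of_derivations hf
      (IsSkewDerivation.sub_characters l m) (x := n) (y := -d) hfn (by simp [hln, hmn]) ?_
    simp only [AddMonoidHom.sub_apply, AddMonoidHom.coe_coe, map_neg, hld, hmd]
    decide
  · refine le_coveringNumber_of_pairwise ![d, d + n, d - n, 1 + n] ?_
    intro i j hij S hi hj
    fin_cases i <;> fin_cases j <;> first | exact absurd hij (by decide) | skip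
    · exact htop S (hone S d hdd hi) hi (by simpa using sub_mem hj hi)
    · exact htop S (hone S d hdd hi) hi (by simpa using sub_mem hi hj)
    · exact htop S (huni S hj).1 hi (huni S hj).2
    · have hd : d ∈ S := hdbl S d (by
        have := add_mem hi hj
        simpa [show d + n + (d - n) = d + d by abel] using this)
      exact htop S (hone S d hdd hd) hd (by simpa using sub_mem hi hd)
    · exact htop S (huni S hj).1 (by simpa using sub_mem hi (huni S hj).2) (huni S hj).2
    · exact htop S (huni S hj).1 (by simpa using add_mem hi (huni S hj).2) (huni S hj).2
  · intro I hI
    obtain ⟨r, hrI, hr0⟩ : ∃ r ∈ I, r ≠ 0 := by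
      by_contra! h
      exact hI (eq_bot_iff.2 fun r hr => (TwoSidedIdeal.mem_bot T).2 (h r hr))
    have hpm : ∀ a : ZMod 3, a ≠ 0 → a = 1 ∨ a = -1 := by decide
    -- Every nonzero ideal contains the radical: `r * n = l r • n` and `n * r = m r • n`, and if
    -- both characters vanish at `r` it is already a multiple of `n`. Modulo `n`, the element `d`
    -- generates because `d² = 1`.
    have hnI : n ∈ I := by
      have hsgn : -n ∈ I → n ∈ I := fun h => by simpa using I.neg_mem h
      by_cases hlr : l r = 0
      · by_cases hmr : m r = 0
        · have hfr : f r ≠ 0 := fun h => hr0 (hinj _ _ (by simp [hlr]) (by simp [hmr]) (by simp [h]))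
          rcases hpm _ hfr with h | h
          · rwa [show n = r from hinj _ _ (by rw [hln, hlr]) (by rw [hmn, hmr]) (by rw [hfn, h])]
          · refine hsgn ?_
            rwa [show -n = r from hinj _ _ (by simp [hln, hlr]) (by simp [hmn, hmr])
              (by simp [hfn, h])]
        · have hmul := I.mul_mem_left n r hrI
          rcases hpm _ hmr with h | h
          · rwa [show n * r = n from hinj _ _ (by simp [hln]) (by simp [hmn])
              (by rw [hf]; simp [hfn, hln, h])] at hmul
          · refine hsgn ?_
            rwa [show n * r = -n from hinj _ _ (by simp [hln]) (by simp [hmn])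
              (by rw [hf]; simp [hfn, hln, h])] at hmul
      · have hmul := I.mul_mem_right r n hrI
        rcases hpm _ hlr with h | h
        · rwa [show r * n = n from hinj _ _ (by simp [hln]) (by simp [hmn])
            (by rw [hf]; simp [hfn, hmn, h])] at hmul
        · refine hsgn ?_
          rwa [show r * n = -n from hinj _ _ (by simp [hln]) (by simp [hmn])
            (by rw [hf]; simp [hfn, hmn, h])] at hmul
    rw [coveringNumber_quotient_eq_top I d
      fun S hS hd => htop S (hone S d hdd hd) hd (hS n hnI)]
    exact ENat.natCast_lt_top 4

end LocalRing

/-! ### The two rings of order 27. -/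

/-- The ring of upper triangular `2 × 2` matrices over `F₃` belongs to `S(4)`. -/
theorem memS_four_upperTriangular : MemS 4 (upperTriangular (ZMod 3)) := by
  have h10 : ∀ M : upperTriangular (ZMod 3), M.1 1 0 = 0 := fun M => M.2
  let l : upperTriangular (ZMod 3) →+* ZMod 3 :=
    { toFun := fun M => M.1 0 0
      map_one' := by simp
      map_zero' := by simp
      map_add' := fun M N => by simp
      map_mul' := fun M N => by simp [Matrix.mul_apply, Fin.sum_univ_two, h10] }
  let m : upperTriangular (ZMod 3) →+* ZMod 3 :=
    { toFun := fun M => M.1 1 1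
      map_one' := by simp
      map_zero' := by simp
      map_add' := fun M N => by simp
      map_mul' := fun M N => by simp [Matrix.mul_apply, Fin.sum_univ_two, h10] }
  let f : upperTriangular (ZMod 3) →+ ZMod 3 :=
    { toFun := fun M => M.1 0 1
      map_zero' := by simp
      map_add' := fun M N => by simp }
  have hf : IsSkewDerivation l m f := by
    intro M N
    show (M.1 * N.1) 0 1 = M.1 0 1 * N.1 1 1 + M.1 0 0 * N.1 0 1
    rw [Matrix.mul_apply, Fin.sum_univ_two]
    ring
  refine memS_four_of_triangular l m f hf ?_
    (d := ⟨!![1, 0; 0, -1], show (!![1, 0; 0, -1] : Matrix (Fin 2) (Fin 2) (ZMod 3)) 1 0 = 0 by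
      simp⟩)
    (n := ⟨!![0, 1; 0, 0], show (!![0, 1; 0, 0] : Matrix (Fin 2) (Fin 2) (ZMod 3)) 1 0 = 0 by
      simp⟩) rfl rfl rfl rfl rfl rfl
  intro M N h1 h2 h3
  ext i j
  fin_cases i <;> fin_cases j
  · exact h1
  · exact h3
  · exact (h10 M).trans (h10 N).symm
  · exact h2

namespace TruncatedPoly

variable {F : Type*} [CommRing F]

open MvPolynomial

/-- The ideal `(x², xy, y²)`. -/
noncomputable abbrev relations (F : Type*) [CommRing F] : Ideal (MvPolynomial (Fin 2) F) :=
  Ideal.span {X 0 ^ 2, X 0 * X 1, X 1 ^ 2}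

/-- The element `a + b x + c y`. -/
noncomputable def linear (a b c : F) : TruncatedPoly F :=
  Ideal.Quotient.mk (relations F) (C a + C b * X 0 + C c * X 1)

theorem mk_X_zero_sq : Ideal.Quotient.mk (relations F) (X 0) * Ideal.Quotient.mk _ (X 0) = 0 := by
  rw [← map_mul, ← sq]
  exact Ideal.Quotient.eq_zero_iff_mem.2 (Ideal.subset_span (by simp))

theorem mk_X_mul : Ideal.Quotient.mk (relations F) (X 0) * Ideal.Quotient.mk _ (X 1) = 0 := by
  rw [← map_mul]
  exact Ideal.Quotient.eq_zero_iff_mem.2 (Ideal.subset_span (by simp))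

theorem mk_X_one_sq : Ideal.Quotient.mk (relations F) (X 1) * Ideal.Quotient.mk _ (X 1) = 0 := by
  rw [← map_mul, ← sq]
  exact Ideal.Quotient.eq_zero_iff_mem.2 (Ideal.subset_span (by simp))

theorem linear_add (a b c a' b' c' : F) :
    linear (a + a') (b + b') (c + c') = linear a b c + linear a' b' c' := by
  simp only [linear, map_add, map_mul]
  ring

theorem linear_mul (a b c a' b' c' : F) :
    linear (a * a') (b * a' + a * b') (c * a' + a * c') = linear a b c * linear a' b' c' := by
  simp only [linear, map_add, map_mul]
  linear_combination
    -(Ideal.Quotient.mk (relations F) (C b) * Ideal.Quotient.mk (relations F) (C b')) *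
        mk_X_zero_sq (F := F) -
      (Ideal.Quotient.mk (relations F) (C b) * Ideal.Quotient.mk (relations F) (C c') +
        Ideal.Quotient.mk (relations F) (C c) * Ideal.Quotient.mk (relations F) (C b')) *
        mk_X_mul (F := F) -
      (Ideal.Quotient.mk (relations F) (C c) * Ideal.Quotient.mk (relations F) (C c')) *
        mk_X_one_sq (F := F)

theorem exists_linear (t : TruncatedPoly F) : ∃ a b c, t = linear a b c := by
  obtain ⟨q, rfl⟩ := Ideal.Quotient.mk_surjective t
  induction q using MvPolynomial.induction_on with
  | C a => exact ⟨a, 0, 0, by simp [linear]⟩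
  | add q r hq hr =>
    obtain ⟨a, b, c, h⟩ := hq
    obtain ⟨a', b', c', h'⟩ := hr
    exact ⟨a + a', b + b', c + c', by rw [map_add, h, h', linear_add]⟩
  | mul_X q i hq =>
    obtain ⟨a, b, c, h⟩ := hq
    fin_cases i
    · refine ⟨a * 0, b * 0 + a * 1, c * 0 + a * 0, ?_⟩
      have hX : Ideal.Quotient.mk (relations F) (X 0) = linear 0 1 0 := by simp [linear]
      rw [linear_mul, ← h, ← hX, ← map_mul]
      rfl
    · refine ⟨a * 0, b * 0 + a * 0, c * 0 + a * 1, ?_⟩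
      have hX : Ideal.Quotient.mk (relations F) (X 1) = linear 0 0 1 := by simp [linear]
      rw [linear_mul, ← h, ← hX, ← map_mul]
      rfl

/-- The infinitesimals to which `x` and `y` are sent. -/
def infinitesimal (F : Type*) [CommRing F] : Fin 2 → TrivSqZeroExt F (F × F) :=
  ![TrivSqZeroExt.inr (1, 0), TrivSqZeroExt.inr (0, 1)]

theorem aeval_infinitesimal_eq_zero {q : MvPolynomial (Fin 2) F} (hq : q ∈ relations F) :
    aeval (infinitesimal F) q = 0 := by
  have hle : relations F ≤ RingHom.ker (aeval (R := F) (infinitesimal F)).toRingHom := by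
    refine Ideal.span_le.2 ?_
    rintro _ (rfl | rfl | rfl) <;> simp [RingHom.mem_ker, sq, infinitesimal]
  exact hle hq

/-- The map recording the coefficients of `1`, `x`, `y`. -/
noncomputable def coeffs (F : Type*) [CommRing F] : TruncatedPoly F →+* TrivSqZeroExt F (F × F) :=
  Ideal.Quotient.lift (relations F) (aeval (R := F) (infinitesimal F)).toRingHom
    fun _ => aeval_infinitesimal_eq_zero

theorem coeffs_linear (a b c : F) :
    coeffs F (linear a b c) = TrivSqZeroExt.inl a + TrivSqZeroExt.inr (b, c) := by
  rw [linear, coeffs, Ideal.Quotient.lift_mk]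
  simp [infinitesimal, TrivSqZeroExt.ext_iff, TrivSqZeroExt.algebraMap_eq_inl]

end TruncatedPoly

open TruncatedPoly in
/-- The ring `F₃[x, y] / (x², xy, y²)` belongs to `S(4)`. -/
theorem memS_four_truncatedPoly : MemS 4 (TruncatedPoly (ZMod 3)) := by
  let l : TruncatedPoly (ZMod 3) →+* ZMod 3 :=
    (TrivSqZeroExt.fstHom (ZMod 3) (ZMod 3) (ZMod 3 × ZMod 3)).toRingHom.comp (coeffs (ZMod 3))
  let f : TruncatedPoly (ZMod 3) →+ ZMod 3 :=
    { toFun := fun t => (coeffs (ZMod 3) t).snd.1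
      map_zero' := by simp
      map_add' := fun s t => by simp }
  let g : TruncatedPoly (ZMod 3) →+ ZMod 3 :=
    { toFun := fun t => (coeffs (ZMod 3) t).snd.2
      map_zero' := by simp
      map_add' := fun s t => by simp }
  have hl : ∀ a b c, l (linear a b c) = a := by
    intro a b c
    show (coeffs (ZMod 3) (linear a b c)).fst = a
    rw [coeffs_linear]; simp
  have hfl : ∀ a b c, f (linear a b c) = b := by
    intro a b c
    show (coeffs (ZMod 3) (linear a b c)).snd.1 = b
    rw [coeffs_linear]; simp
  have hgl : ∀ a b c, g (linear a b c) = c := by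
    intro a b c
    show (coeffs (ZMod 3) (linear a b c)).snd.2 = c
    rw [coeffs_linear]; simp
  have hf : IsSkewDerivation l l f := by
    intro r s
    obtain ⟨a, b, c, rfl⟩ := exists_linear r
    obtain ⟨a', b', c', rfl⟩ := exists_linear s
    rw [← linear_mul]
    simp only [hl, hfl]
  have hg : IsSkewDerivation l l g := by
    intro r s
    obtain ⟨a, b, c, rfl⟩ := exists_linear r
    obtain ⟨a', b', c', rfl⟩ := exists_linear s
    rw [← linear_mul]
    simp only [hl, hgl]
  refine memS_four_of_two_derivations l f g hf hg ?_ (x := linear 0 1 0) (y := linear 0 0 1)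
    (hl _ _ _) (hfl _ _ _) (hgl _ _ _) (hl _ _ _) (hfl _ _ _) (hgl _ _ _)
  intro r s h1 h2 h3
  obtain ⟨a, b, c, rfl⟩ := exists_linear r
  obtain ⟨a', b', c', rfl⟩ := exists_linear s
  simp only [hl, hfl, hgl] at h1 h2 h3
  rw [h1, h2, h3]

/-- A pair of derivations along a character gives a homomorphism to `F[x, y] / (x², xy, y²)`. -/
noncomputable def truncatedPolyHom {R : Type*} [Ring R] {p : ℕ} (l : R →+* ZMod p)
    (f g : R →+ ZMod p) (hf : IsSkewDerivation l l f) (hg : IsSkewDerivation l l g) :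
    R →+* TruncatedPoly (ZMod p) where
  toFun r := TruncatedPoly.linear (l r) (f r) (g r)
  map_one' := by
    rw [map_one, hf.map_one, hg.map_one]
    simp [TruncatedPoly.linear]
  map_zero' := by simp [TruncatedPoly.linear]
  map_add' r s := by rw [map_add, map_add, map_add, TruncatedPoly.linear_add]
  map_mul' r s := by rw [map_mul, hf, hg, TruncatedPoly.linear_mul]

/-- A member of `S(4)` carrying two independent derivations into `ZMod 3` is one of the two
rings of order `27`. -/
theorem MemS.of_derivations {R : Type*} [Ring R] (hR : MemS 4 R) {l m : R →+* ZMod 3}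
    {f g : R →+ ZMod 3} (hf : IsSkewDerivation l m f) (hg : IsSkewDerivation l m g) {x y : R}
    (hfx : f x = 1) (hgx : g x = 0) (hfy : f y = 0) (hgy : g y = 1) :
    Nonempty (R ≃+* TruncatedPoly (ZMod 3)) ∨ Nonempty (R ≃+* upperTriangular (ZMod 3)) := by
  have hval : ∀ (k : R →+* ZMod 3) (c : ZMod 3) (z : R), k (c.val • z) = c * k z :=
    fun k c z => map_val_nsmul (k : R →+ ZMod 3) c z
  by_cases hlm : l = m
  · subst hlm
    left
    refine hR.nonempty_ringEquiv (truncatedPolyHom l f g hf hg) (fun t => ?_)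
      memS_four_truncatedPoly.1.le
    obtain ⟨a, b, c, rfl⟩ := TruncatedPoly.exists_linear t
    refine ⟨(a - b * l x - c * l y).val • 1 + b.val • x + c.val • y, ?_⟩
    show TruncatedPoly.linear _ _ _ = _
    simp only [map_add, hval, map_val_nsmul, map_one, hf.map_one, hg.map_one, hfx, hgx, hfy, hgy]
    congr 1 <;> ring
  · right
    obtain ⟨t, ht⟩ : ∃ t, l t ≠ m t := by
      by_contra! h
      exact hlm (RingHom.ext h)
    obtain ⟨e, hle, hme⟩ : ∃ e, l e = 1 ∧ m e = 0 := by
      have hne : l t - m t ≠ 0 := sub_ne_zero.2 ht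
      refine ⟨((l t - m t)⁻¹).val • (t - (m t).val • 1), ?_, ?_⟩
      · rw [hval, map_sub, hval, map_one, mul_one, inv_mul_cancel₀ hne]
      · rw [hval, map_sub, hval, map_one, mul_one, sub_self, mul_zero]
    -- Surjectivity needs a derivation independent of `l - m`. As `l - m` equals 1 at `e`, any
    -- nonzero combination of `f` and `g` vanishing at `e` will do.
    obtain ⟨h, w, hh, hhe, hhw⟩ : ∃ (h : R →+ ZMod 3) (w : R),
        IsSkewDerivation l m h ∧ h e = 0 ∧ h w = 1 := by
      by_cases hfe : f e = 0
      · exact ⟨f, x, hf, hfe, hfx⟩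
      · refine ⟨g - (AddMonoidHom.mulLeft (g e * (f e)⁻¹)).comp f, y,
          hg.sub (hf.mulLeft_comp _), ?_, ?_⟩
        · simp only [AddMonoidHom.sub_apply, AddMonoidHom.comp_apply, AddMonoidHom.coe_mulLeft]
          rw [mul_assoc, inv_mul_cancel₀ hfe, mul_one, sub_self]
        · simp only [AddMonoidHom.sub_apply, AddMonoidHom.comp_apply, AddMonoidHom.coe_mulLeft]
          rw [hfy, hgy, mul_zero, sub_zero]
    refine hR.nonempty_ringEquiv (upperTriangularHom l m h hh) (fun M => ?_)
      memS_four_upperTriangular.1.le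
    refine ⟨(M.1 1 1 - M.1 0 1 * m w).val • 1 +
      (M.1 0 0 - M.1 1 1 - M.1 0 1 * (l w - m w)).val • e + (M.1 0 1).val • w, ?_⟩
    ext i j
    show (!![l _, h _; 0, m _] : Matrix (Fin 2) (Fin 2) (ZMod 3)) i j = _
    simp only [map_add, hval, map_val_nsmul, map_one, hh.map_one, hle, hme, hhe, hhw]
    fin_cases i <;> fin_cases j
    · show _ = M.1 0 0
      simp; ring
    · show _ = M.1 0 1
      simp
    · exact (M.2 : M.1 1 0 = 0).symm
    · show _ = M.1 1 1
      simp

/-! ### The ring `F₄ × F₄`. -/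

section FieldFour

/-- An element other than 0 and 1 is a root of the last factor of `a⁴ - a = a (a - 1) (a² + a + 1)`.
The explicit list reduces later work in `F₄` to cases. -/
theorem GaloisField.four_elements :
    ∃ w : GaloisField 2 2, w * w = w + 1 ∧ ∀ a, a = 0 ∨ a = 1 ∨ a = w ∨ a = w + 1 := by
  have hcard : Nat.card (GaloisField 2 2) = 4 := GaloisField.card 2 2 (by norm_num)
  have : Finite (GaloisField 2 2) := Nat.finite_of_card_ne_zero (by rw [hcard]; norm_num)
  have := Fintype.ofFinite (GaloisField 2 2)
  have hcard' : Fintype.card (GaloisField 2 2) = 4 := by rw [← Nat.card_eq_fintype_card, hcard]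
  have hpow : ∀ a : GaloisField 2 2, a ^ 4 = a := fun a => by
    rw [← hcard']; exact FiniteField.pow_card a
  have h2 : (2 : GaloisField 2 2) = 0 := CharP.cast_eq_zero _ 2
  have hquad : ∀ a : GaloisField 2 2, a ≠ 0 → a ≠ 1 → a * a = a + 1 := by
    intro a h0 h1
    have h : a * ((a - 1) * (a * a + a + 1)) = 0 := by linear_combination hpow a
    have h' := (mul_eq_zero.1 ((mul_eq_zero.1 h).resolve_left h0)).resolve_left (sub_ne_zero.2 h1)
    linear_combination h' - (a + 1) * h2
  classical
  obtain ⟨w, hw⟩ : ∃ w : GaloisField 2 2, w ∉ ({0, 1} : Finset (GaloisField 2 2)) := by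
    by_contra! h
    have := Finset.card_le_card (fun a _ => h a :
      (Finset.univ : Finset (GaloisField 2 2)) ⊆ {0, 1})
    rw [Finset.card_univ, hcard'] at this
    have := this.trans Finset.card_le_two
    omega
  simp only [Finset.mem_insert, Finset.mem_singleton, not_or] at hw
  refine ⟨w, hquad w hw.1 hw.2, fun a => ?_⟩
  by_cases h0 : a = 0
  · exact Or.inl h0
  by_cases h1 : a = 1
  · exact Or.inr (Or.inl h1)
  have h : (a - w) * (a - (w + 1)) = 0 := by
    linear_combination hquad a h0 h1 + hquad w hw.1 hw.2 + (w + 1 - a * w) * h2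
  rcases mul_eq_zero.1 h with h | h
  · exact Or.inr (Or.inr (Or.inl (sub_eq_zero.1 h)))
  · exact Or.inr (Or.inr (Or.inr (sub_eq_zero.1 h)))

theorem NonUnitalSubring.ne_top_of_notMem {R : Type*} [NonUnitalRing R] {S : NonUnitalSubring R}
    {r : R} (hr : r ∉ S) : S ≠ ⊤ := fun h => hr (h ▸ NonUnitalSubring.mem_top r)

/-- The preimage of the idempotents of a commutative ring of characteristic two. -/
def idempotentSubring {R F : Type*} [Ring R] [CommRing F] [CharP F 2] (φ : R →+* F) :
    NonUnitalSubring R where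
  carrier := {r | φ r * φ r = φ r}
  zero_mem' := by simp
  add_mem' := by
    intro a b ha hb
    simp only [Set.mem_ofPred_eq] at ha hb ⊢
    have h2 : (2 : F) = 0 := CharP.cast_eq_zero F 2
    rw [map_add]
    linear_combination ha + hb + φ a * φ b * h2
  neg_mem' := by
    intro a ha
    simp only [Set.mem_ofPred_eq] at ha ⊢
    have h2 : (2 : F) = 0 := CharP.cast_eq_zero F 2
    rw [map_neg]
    linear_combination ha + φ a * h2
  mul_mem' := by
    intro a b ha hb
    simp only [Set.mem_ofPred_eq] at ha hb ⊢
    rw [map_mul]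
    linear_combination φ b * φ b * ha + φ a * hb

/-- The locus where two homomorphisms agree. -/
def equalizerSubring {R F : Type*} [Ring R] [Ring F] (φ ψ : R →+* F) : NonUnitalSubring R where
  carrier := {r | φ r = ψ r}
  zero_mem' := by simp
  add_mem' := by
    intro a b ha hb
    simp only [Set.mem_ofPred_eq] at ha hb ⊢
    rw [map_add, map_add, ha, hb]
  neg_mem' := by
    intro a ha
    simp only [Set.mem_ofPred_eq] at ha ⊢
    rw [map_neg, map_neg, ha]
  mul_mem' := by
    intro a b ha hb
    simp only [Set.mem_ofPred_eq] at ha hb ⊢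
    rw [map_mul, map_mul, ha, hb]

/-- The square of a field with four elements belongs to `S(4)`. -/
theorem memS_four_field_prod {F : Type*} [Field F] [CharP F 2] {w : F} (hw : w * w = w + 1)
    (hall : ∀ a, a = 0 ∨ a = 1 ∨ a = w ∨ a = w + 1) : MemS 4 (F × F) := by
  have h2 : (2 : F) = 0 := CharP.cast_eq_zero F 2
  have hw0 : w ≠ 0 := by rintro rfl; simp at hw
  have hww : w * w ≠ w := fun h => one_ne_zero (α := F) (by linear_combination h - hw)
  let F₁ : F × F →+* F := RingHom.fst F F
  let F₂ : F × F →+* F := RingHom.snd F F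
  have key : ∀ S : NonUnitalSubring (F × F), (1, 0) ∈ S → (0, 1) ∈ S →
      (∃ b, (w, b) ∈ S) → (∃ a, (a, w) ∈ S) → S = ⊤ := by
    rintro S h10 h01 ⟨b, hb⟩ ⟨a, ha⟩
    have hw0 : (w, 0) ∈ S := by simpa using mul_mem hb h10
    have h0w : (0, w) ∈ S := by simpa using mul_mem ha h01
    have hl : ∀ c, (c, (0 : F)) ∈ S := by
      intro c
      rcases hall c with rfl | rfl | rfl | rfl
      · exact S.zero_mem
      · exact h10
      · exact hw0
      · simpa using add_mem hw0 h10
    have hr : ∀ c, ((0 : F), c) ∈ S := by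
      intro c
      rcases hall c with rfl | rfl | rfl | rfl
      · exact S.zero_mem
      · exact h01
      · exact h0w
      · simpa using add_mem h0w h01
    refine eq_top_iff.2 fun c _ => ?_
    have := add_mem (hl c.1) (hr c.2)
    simpa using this
  refine ⟨le_antisymm ?_ ?_, ?_⟩
  -- The subrings are `F₂ × F₄`, `F₄ × F₂` and the graphs of the two automorphisms of `F₄`: if
  -- neither coordinate is in `F₂`, the coordinates are equal or conjugate.
  · refine coveringNumber_le_of_family ![idempotentSubring F₁, idempotentSubring F₂,
      equalizerSubring F₁ F₂, equalizerSubring ((frobenius F 2).comp F₁) F₂] ?_ ?_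
    · intro i
      fin_cases i
      · exact NonUnitalSubring.ne_top_of_notMem (r := (w, 0)) hww
      · exact NonUnitalSubring.ne_top_of_notMem (r := (0, w)) hww
      · exact NonUnitalSubring.ne_top_of_notMem (r := (w, 0)) hw0
      · refine NonUnitalSubring.ne_top_of_notMem (r := (0, w)) fun h => ?_
        have h' : (frobenius F 2) 0 = w := h
        rw [map_zero] at h'
        exact hw0 h'.symm
    · rintro ⟨a, b⟩
      have hsq : (w + 1) ^ 2 = w := by linear_combination hw + (w + 1) * h2
      have hsq' : w ^ 2 = w + 1 := by linear_combination hw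
      have hF : ∀ c : F, frobenius F 2 c = c ^ 2 := fun c => frobenius_def _ _
      rcases hall a with rfl | rfl | ha
      · exact ⟨0, show (0 : F) * 0 = 0 by simp⟩
      · exact ⟨0, show (1 : F) * 1 = 1 by simp⟩
      rcases hall b with rfl | rfl | hb
      · exact ⟨1, show (0 : F) * 0 = 0 by simp⟩
      · exact ⟨1, show (1 : F) * 1 = 1 by simp⟩
      by_cases hab : a = b
      · exact ⟨2, hab⟩
      · refine ⟨3, show frobenius F 2 a = b from ?_⟩
        rw [hF]
        rcases ha with rfl | rfl <;> rcases hb with rfl | rfl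
        · exact absurd rfl hab
        · exact hsq'
        · exact hsq
        · exact absurd rfl hab
  · refine le_coveringNumber_of_pairwise
      ![((w, w) : F × F), (w, w + 1), (w, 1), (1, w)] ?_
    have hc : ∀ S : NonUnitalSubring (F × F), (1, 1) ∈ S → (1, 0) ∈ S → (0, 1) ∈ S := by
      intro S h11 h10
      simpa using sub_mem h11 h10
    have hc' : ∀ S : NonUnitalSubring (F × F), (1, 1) ∈ S → (0, 1) ∈ S → (1, 0) ∈ S := by
      intro S h11 h10
      simpa using sub_mem h11 h10
    -- The map `a ↦ a² - a` is 0 on `F₂` and 1 off it, so it extracts idempotents from the chosen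
    -- pairs.
    have hsub : w * w - w = 1 := by rw [hw]; ring
    have hsub' : (w + 1) * (w + 1) - (w + 1) = 1 := by linear_combination hw + w * h2
    intro i j hij S hi hj
    fin_cases i <;> fin_cases j <;> first | exact absurd hij (by decide) | skip
    · have hp : (w, w) ∈ S := hi
      have hq : (w, w + 1) ∈ S := hj
      have h01 : ((0 : F), (1 : F)) ∈ S := by simpa using sub_mem hq hp
      have h11 : ((1 : F), (1 : F)) ∈ S := by simpa [hsub] using sub_mem (mul_mem hp hp) hp
      exact key S (hc' S h11 h01) h01 ⟨_, hp⟩ ⟨_, hp⟩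
    · have hp : (w, w) ∈ S := hi
      have hq : (w, 1) ∈ S := hj
      have h11 : ((1 : F), (1 : F)) ∈ S := by simpa [hsub] using sub_mem (mul_mem hp hp) hp
      have h10 : ((1 : F), (0 : F)) ∈ S := by simpa [hsub] using sub_mem (mul_mem hq hq) hq
      exact key S h10 (hc S h11 h10) ⟨_, hp⟩ ⟨_, hp⟩
    · have hp : (w, w) ∈ S := hi
      have hq : (1, w) ∈ S := hj
      have h11 : ((1 : F), (1 : F)) ∈ S := by simpa [hsub] using sub_mem (mul_mem hp hp) hp
      have h01 : ((0 : F), (1 : F)) ∈ S := by simpa [hsub] using sub_mem (mul_mem hq hq) hq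
      exact key S (hc' S h11 h01) h01 ⟨_, hp⟩ ⟨_, hp⟩
    · have hp : (w, w + 1) ∈ S := hi
      have hq : (w, 1) ∈ S := hj
      have h0w : ((0 : F), w) ∈ S := by simpa using sub_mem hp hq
      have h01 : ((0 : F), (1 : F)) ∈ S := by simpa [hsub] using sub_mem (mul_mem h0w h0w) h0w
      have h10 : ((1 : F), (0 : F)) ∈ S := by simpa [hsub] using sub_mem (mul_mem hq hq) hq
      exact key S h10 h01 ⟨_, hp⟩ ⟨_, h0w⟩
    · have hp : (w, w + 1) ∈ S := hi
      have hq : (1, w) ∈ S := hj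
      have h11 : ((1 : F), (1 : F)) ∈ S := by
        have := sub_mem (mul_mem hp hp) hp
        simpa only [Prod.mk_mul_mk, Prod.mk_sub_mk, hsub, hsub'] using this
      have h01 : ((0 : F), (1 : F)) ∈ S := by simpa [hsub] using sub_mem (mul_mem hq hq) hq
      exact key S (hc' S h11 h01) h01 ⟨_, hp⟩ ⟨_, hq⟩
    · have hp : (w, 1) ∈ S := hi
      have hq : (1, w) ∈ S := hj
      have h10 : ((1 : F), (0 : F)) ∈ S := by simpa [hsub] using sub_mem (mul_mem hp hp) hp
      have h01 : ((0 : F), (1 : F)) ∈ S := by simpa [hsub] using sub_mem (mul_mem hq hq) hq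
      exact key S h10 h01 ⟨_, hp⟩ ⟨_, hq⟩
  · intro I hI
    have hsub : w * w - w = 1 := by rw [hw]; ring
    obtain ⟨n, hnI, hn0⟩ : ∃ n ∈ I, n ≠ 0 := by
      by_contra! h
      exact hI (eq_bot_iff.2 fun r hr => (TwoSidedIdeal.mem_bot _).2 (h r hr))
    suffices h : ∃ u : F × F, ∀ S : NonUnitalSubring (F × F), (∀ r ∈ I, r ∈ S) → u ∈ S → S = ⊤ by
      obtain ⟨u, hu⟩ := h
      rw [coveringNumber_quotient_eq_top I u hu]
      exact ENat.natCast_lt_top 4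
    by_cases h1 : n.1 = 0
    · have h2 : n.2 ≠ 0 := fun h => hn0 (Prod.ext h1 h)
      have hI2 : ∀ c : F, ((0 : F), c) ∈ I := by
        intro c
        have := I.mul_mem_left (0, c * (n.2)⁻¹) n hnI
        rwa [show ((0, c * (n.2)⁻¹) : F × F) * n = (0, c) from Prod.ext (by simp)
          (by simp [mul_assoc, inv_mul_cancel₀ h2])] at this
      refine ⟨(w, 0), fun S hS hu => ?_⟩
      have h10 : ((1 : F), (0 : F)) ∈ S := by simpa [hsub] using sub_mem (mul_mem hu hu) hu
      exact key S h10 (hS _ (hI2 1)) ⟨_, hu⟩ ⟨_, hS _ (hI2 w)⟩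
    · have hI1 : ∀ c : F, (c, (0 : F)) ∈ I := by
        intro c
        have := I.mul_mem_left (c * (n.1)⁻¹, 0) n hnI
        rwa [show ((c * (n.1)⁻¹, 0) : F × F) * n = (c, 0) from Prod.ext
          (by simp [mul_assoc, inv_mul_cancel₀ h1]) (by simp)] at this
      refine ⟨(0, w), fun S hS hu => ?_⟩
      have h01 : ((0 : F), (1 : F)) ∈ S := by simpa [hsub] using sub_mem (mul_mem hu hu) hu
      exact key S (hS _ (hI1 1)) h01 ⟨_, hS _ (hI1 w)⟩ ⟨_, hu⟩

/-- The ring `F₄ × F₄` belongs to `S(4)`. -/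
theorem memS_four_galoisField_prod : MemS 4 (GaloisField 2 2 × GaloisField 2 2) := by
  obtain ⟨w, hw, hall⟩ := GaloisField.four_elements
  exact memS_four_field_prod hw hall

end FieldFour

/-! ### The ring `M₂(F₂)`. -/

section MatrixTwo

/-- The matrices having the row vector `(a, b)` as a left eigenvector. -/
def rowStabilizer (a b : ZMod 2) : NonUnitalSubring (Matrix (Fin 2) (Fin 2) (ZMod 2)) where
  carrier := {M | (a * M 0 0 + b * M 1 0) * b = (a * M 0 1 + b * M 1 1) * a}
  zero_mem' := by simp
  add_mem' := by
    intro M N hM hN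
    simp only [Set.mem_ofPred_eq, Matrix.add_apply] at hM hN ⊢
    linear_combination hM + hN
  neg_mem' := by
    intro M hM
    simp only [Set.mem_ofPred_eq, Matrix.neg_apply] at hM ⊢
    linear_combination -hM
  mul_mem' := by
    intro M N hM hN
    simp only [Set.mem_ofPred_eq, Matrix.mul_apply, Fin.sum_univ_two] at hM hN ⊢
    revert hM hN
    generalize M 0 0 = m₁
    generalize M 0 1 = m₂
    generalize M 1 0 = m₃
    generalize M 1 1 = m₄
    generalize N 0 0 = n₁
    generalize N 0 1 = n₂
    generalize N 1 0 = n₃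
    generalize N 1 1 = n₄
    have hsq : ∀ c : ZMod 2, c = 0 ∨ c = 1 := by decide
    rcases hsq a with rfl | rfl <;> rcases hsq b with rfl | rfl <;> intro hM hN
    · simp
    · simp at hM hN ⊢
      simp [hM, hN]
    · simp at hM hN ⊢
      simp [← hM, ← hN]
    · simp at hM hN ⊢
      linear_combination (m₁ + m₃) * hN + (n₄ - n₃) * hM

/-- A matrix of order three. -/
def orderThree : Matrix (Fin 2) (Fin 2) (ZMod 2) := !![0, 1; 1, 1]

/-- The ring of `2 × 2` matrices over `F₂` belongs to `S(4)`. -/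
theorem memS_four_matrix : MemS 4 (Matrix (Fin 2) (Fin 2) (ZMod 2)) := by
  refine ⟨le_antisymm ?_ ?_, ?_⟩
  · refine coveringNumber_le_of_family ![rowStabilizer 1 0, rowStabilizer 0 1, rowStabilizer 1 1,
      (Subring.centralizer {orderThree}).toNonUnitalSubring] ?_ ?_
    · intro i
      fin_cases i
      · exact NonUnitalSubring.ne_top_of_notMem (r := orderThree)
          fun h => absurd (show _ = _ from h) (by decide)
      · exact NonUnitalSubring.ne_top_of_notMem (r := orderThree)
          fun h => absurd (show _ = _ from h) (by decide)
      · exact NonUnitalSubring.ne_top_of_notMem (r := orderThree)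
          fun h => absurd (show _ = _ from h) (by decide)
      · exact NonUnitalSubring.ne_top_of_notMem (r := !![1, 0; 0, 0])
          fun h => absurd (Subring.mem_centralizer_iff.1 h orderThree rfl) (by decide)
    · intro M
      -- A matrix fixing none of the three lines has characteristic polynomial `X² + X + 1`, hence
      -- is `orderThree` or its square.
      have key : ∀ a b c d : ZMod 2, b = 0 ∨ c = 0 ∨ a + c = b + d ∨
          orderThree * !![a, b; c, d] = !![a, b; c, d] * orderThree := by decide
      rcases key (M 0 0) (M 0 1) (M 1 0) (M 1 1) with h | h | h | h
      · exact ⟨0, show (1 * M 0 0 + 0 * M 1 0) * 0 = (1 * M 0 1 + 0 * M 1 1) * 1 by simp [h]⟩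
      · exact ⟨1, show (0 * M 0 0 + 1 * M 1 0) * 1 = (0 * M 0 1 + 1 * M 1 1) * 0 by simp [h]⟩
      · exact ⟨2, show (1 * M 0 0 + 1 * M 1 0) * 1 = (1 * M 0 1 + 1 * M 1 1) * 1 by simp [h]⟩
      · refine ⟨3, show M ∈ Subring.centralizer {orderThree} from Subring.mem_centralizer_iff.2 ?_⟩
        rintro _ rfl
        rw [← Matrix.eta_fin_two] at h
        exact h
  · have gen : ∀ (p q : Matrix (Fin 2) (Fin 2) (ZMod 2)),
        (∀ a b c d : ZMod 2, ∃ i j k l m : Fin 2, !![a, b; c, d] =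
          i.val • p + j.val • q + k.val • (p * q) + l.val • (q * p) + m.val • (p * p)) →
        ∀ S : NonUnitalSubring (Matrix (Fin 2) (Fin 2) (ZMod 2)), p ∈ S → q ∈ S → S = ⊤ := by
      intro p q h S hp hq
      refine eq_top_iff.2 fun M _ => ?_
      obtain ⟨i, j, k, l, m, hM⟩ := h (M 0 0) (M 0 1) (M 1 0) (M 1 1)
      rw [← Matrix.eta_fin_two] at hM
      rw [hM]
      exact add_mem (add_mem (add_mem (add_mem (nsmul_mem hp _) (nsmul_mem hq _))
        (nsmul_mem (mul_mem hp hq) _)) (nsmul_mem (mul_mem hq hp) _)) (nsmul_mem (mul_mem hp hp) _)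
    -- An element of order three together with the three involutions of `GL₂(F₂)`, each of which
    -- fixes a single line.
    refine le_coveringNumber_of_pairwise ![orderThree, !![0, 1; 1, 0], !![1, 1; 0, 1],
      !![1, 0; 1, 1]] ?_
    intro i j hij
    fin_cases i <;> fin_cases j <;> first | exact absurd hij (by decide) | skip
    all_goals exact gen _ _ (by decide)
  · intro I hI
    have : IsSimpleRing (Matrix (Fin 2) (Fin 2) (ZMod 2)) := inferInstance
    have hIt : I = ⊤ := (eq_bot_or_eq_top I).resolve_left hI
    rw [coveringNumber_quotient_eq_top I 0 fun S hS _ => eq_top_iff.2 fun r _ =>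
      hS r (hIt ▸ trivial)]
    exact ENat.natCast_lt_top 4

end MatrixTwo

/-! ### Subrings of index two and representations over `F₂`. -/

section Two

variable {R : Type*} [Ring R]

/-- Two distinct characters to `ZMod 2` give a cover by three subrings. -/
theorem coveringNumber_le_three_of_characters {l m : R →+* ZMod 2} (h : l ≠ m) :
    coveringNumber R ≤ 3 := by
  obtain ⟨t, ht⟩ : ∃ t, l t ≠ m t := by
    by_contra! h'
    exact h (RingHom.ext h')
  have hmul : ∀ k : R →+* ZMod 2, ∀ r s, (k : R →+ ZMod 2) r = 0 → (k : R →+ ZMod 2) s = 0 →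
      (k : R →+ ZMod 2) (r * s) = 0 := by
    intro k r s hr _
    simp only [AddMonoidHom.coe_coe] at hr ⊢
    rw [map_mul, hr, zero_mul]
  refine coveringNumber_le_of_family ![kerSubring (l : R →+ ZMod 2) (hmul l),
    kerSubring (m : R →+ ZMod 2) (hmul m), equalizerSubring l m] ?_ ?_
  · intro i
    fin_cases i
    · exact kerSubring_ne_top (r := 1) (by simp)
    · exact kerSubring_ne_top (r := 1) (by simp)
    · exact NonUnitalSubring.ne_top_of_notMem (r := t) ht
  · intro r
    have key : ∀ a b : ZMod 2, a = 0 ∨ b = 0 ∨ a = b := by decide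
    rcases key (l r) (m r) with h | h | h
    · exact ⟨0, h⟩
    · exact ⟨1, h⟩
    · exact ⟨2, h⟩

/-- Two distinct nonzero derivations to `ZMod 2` give a cover by three subrings. -/
theorem coveringNumber_le_three_of_derivations {l m : R →+* ZMod 2} {f g : R →+ ZMod 2}
    (hf : IsSkewDerivation l m f) (hg : IsSkewDerivation l m g) {x y z : R}
    (hx : f x ≠ 0) (hy : g y ≠ 0) (hz : f z ≠ g z) : coveringNumber R ≤ 3 := by
  refine coveringNumber_le_of_family ![kerSubring f hf.ker_mul, kerSubring g hg.ker_mul,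
    kerSubring _ (hf.sub hg).ker_mul] ?_ ?_
  · intro i
    fin_cases i
    · exact kerSubring_ne_top hx
    · exact kerSubring_ne_top hy
    · exact kerSubring_ne_top (r := z) (sub_ne_zero.2 hz)
  · intro r
    have key : ∀ a b : ZMod 2, a = 0 ∨ b = 0 ∨ a - b = 0 := by decide
    rcases key (f r) (g r) with h | h | h
    · exact ⟨0, h⟩
    · exact ⟨1, h⟩
    · exact ⟨2, h⟩

/-- A unital subring of prime index is the preimage of the lower triangular matrices under a
homomorphism to `2 × 2` matrices. -/
def matrixHom {p : ℕ} [NeZero p] (f : R →+ ZMod p)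
    (hf : ∀ r s, f r = 0 → f s = 0 → f (r * s) = 0) (x : R) (hx : f x = 1) (h1 : f 1 = 0) :
    R →+* Matrix (Fin 2) (Fin 2) (ZMod p) where
  -- The form `f (r * s)` depends on `r` only through the pair `(f (r * x), f r)`, so it has rank at
  -- most two. The first row is this pair, the second the same pair for `x * r - f (x * x) • r`.
  toFun r := !![f (r * x), f r; f (x * r * x) - f (x * x) * f (r * x), f (x * r) - f (x * x) * f r]
  map_one' := by
    ext i j
    fin_cases i <;> fin_cases j <;> simp [hx, h1]
  map_zero' := by
    ext i j
    fin_cases i <;> fin_cases j <;> simp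
  map_add' r s := by
    ext i j
    fin_cases i <;> fin_cases j <;> simp [add_mul, mul_add] <;> ring
  map_mul' r s := by
    have h := map_mul_of_ker_mul f hf hx
    have e1 := h r s
    have e2 := h r (s * x)
    have e3 := h (x * r) s
    have e4 := h (x * r) (s * x)
    simp only [← mul_assoc] at e2 e3 e4
    ext i j
    fin_cases i <;> fin_cases j <;> simp [← mul_assoc]
    · linear_combination e2
    · linear_combination e1
    · linear_combination e4 - f (x * x) * e2
    · linear_combination e3 - f (x * x) * e1

/-- The centralizer consists of the matrices `a + b • orderThree`, a copy of `F₄`. -/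
theorem Matrix.commute_orderThree_iff (a b c d : ZMod 2) :
    orderThree * !![a, b; c, d] = !![a, b; c, d] * orderThree ↔ c = b ∧ d = a + b := by
  revert a b c d
  decide

/-- A subring of `M₂(F₂)` containing an element of order three is either everything or
centralizes that element. -/
theorem Subring.eq_top_or_commute_orderThree (S : Subring (Matrix (Fin 2) (Fin 2) (ZMod 2)))
    (hw : orderThree ∈ S) : S = ⊤ ∨ ∀ s ∈ S, orderThree * s = s * orderThree := by
  by_cases h : ∀ s ∈ S, orderThree * s = s * orderThree
  · exact Or.inr h
  · push Not at h
    obtain ⟨s, hs, hne⟩ := h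
    left
    -- `M₂(F₂)` is a plane over the field generated by `orderThree`, and an `s` outside this field
    -- completes 1 to a basis.
    have key : ∀ a b c d : ZMod 2, orderThree * !![a, b; c, d] ≠ !![a, b; c, d] * orderThree →
        ∀ a' b' c' d' : ZMod 2, ∃ i j k l : Fin 2, !![a', b'; c', d'] =
          i.val • 1 + j.val • orderThree + k.val • !![a, b; c, d] +
            l.val • (orderThree * !![a, b; c, d]) := by
      decide
    refine eq_top_iff.2 fun t _ => ?_
    have hkey := key (s 0 0) (s 0 1) (s 1 0) (s 1 1)
    rw [← Matrix.eta_fin_two] at hkey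
    obtain ⟨i, j, k, l, ht⟩ := hkey hne (t 0 0) (t 0 1) (t 1 0) (t 1 1)
    rw [← Matrix.eta_fin_two] at ht
    rw [ht]
    exact add_mem (add_mem (add_mem (nsmul_mem S.one_mem _) (nsmul_mem hw _)) (nsmul_mem hs _))
      (nsmul_mem (mul_mem hw hs) _)

/-- A subring of `M₂(F₂)` fixing none of the three lines contains an element of order three. -/
theorem Subring.orderThree_mem {S : Subring (Matrix (Fin 2) (Fin 2) (ZMod 2))}
    {m a b : Matrix (Fin 2) (Fin 2) (ZMod 2)} (hm : m ∈ S) (ha : a ∈ S) (hb : b ∈ S)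
    (hm1 : m 0 1 ≠ 0) (ha1 : a 1 0 ≠ 0) (hb1 : b 0 0 + b 1 0 ≠ b 0 1 + b 1 1) :
    orderThree ∈ S := by
  -- Subtracting a scalar clears the upper left entry and affects none of the three hypotheses;
  -- fewer unknown bits remain for the search.
  have hnorm : ∀ s ∈ S, !![0, s 0 1; s 1 0, s 1 1 - s 0 0] ∈ S := by
    intro s hs
    have hbit : ∀ c : ZMod 2, c = 0 ∨ c = 1 := by decide
    rcases hbit (s 0 0) with h | h
    · rwa [show !![0, s 0 1; s 1 0, s 1 1 - s 0 0] = s by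
        ext i j
        fin_cases i <;> fin_cases j <;> simp [h]]
    · rw [show !![0, s 0 1; s 1 0, s 1 1 - s 0 0] = s - 1 by
        ext i j
        fin_cases i <;> fin_cases j <;> simp [h]]
      exact sub_mem hs S.one_mem
  have key : ∀ m₂ m₃ a₁ a₃ b₁ b₂ b₃ : ZMod 2, b₂ ≠ b₁ + b₃ →
      ∃ i j k l n o : Fin 2, orderThree =
        i.val • 1 + j.val • !![0, 1; m₂, m₃] + k.val • !![0, a₁; 1, a₃] +
          l.val • !![0, b₁; b₂, b₃] + n.val • (!![0, 1; m₂, m₃] * !![0, a₁; 1, a₃]) +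
          o.val • (!![0, 1; m₂, m₃] * !![0, b₁; b₂, b₃]) := by
    decide
  have hone : ∀ c : ZMod 2, c ≠ 0 → c = 1 := by decide
  have hm' := hnorm m hm
  have ha' := hnorm a ha
  have hb' := hnorm b hb
  rw [hone _ hm1] at hm'
  rw [hone _ ha1] at ha'
  obtain ⟨i, j, k, l, n, o, h⟩ := key (m 1 0) (m 1 1 - m 0 0) (a 0 1) (a 1 1 - a 0 0)
    (b 0 1) (b 1 0) (b 1 1 - b 0 0) (fun h => hb1 (by linear_combination h))
  rw [h]
  exact add_mem (add_mem (add_mem (add_mem (add_mem (nsmul_mem S.one_mem _) (nsmul_mem hm' _))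
    (nsmul_mem ha' _)) (nsmul_mem hb' _)) (nsmul_mem (mul_mem hm' ha') _))
    (nsmul_mem (mul_mem hm' hb') _)

/-- The homomorphism to the field with four elements obtained from matrices centralizing an
element of order three. -/
def fieldHom {F : Type*} [Field F] [CharP F 2] (M : R →+* Matrix (Fin 2) (Fin 2) (ZMod 2))
    (hM : ∀ r, orderThree * M r = M r * orderThree) {w : F} (hw : w * w = w + 1) : R →+* F where
  toFun r := ZMod.castHom (dvd_refl 2) F (M r 0 0) + ZMod.castHom (dvd_refl 2) F (M r 0 1) * w
  map_one' := by simp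
  map_zero' := by simp
  map_add' r s := by
    simp only [map_add, Matrix.add_apply]
    ring
  map_mul' r s := by
    have hs := hM s
    rw [Matrix.eta_fin_two (M s), Matrix.commute_orderThree_iff] at hs
    simp only [map_mul, Matrix.mul_apply, Fin.sum_univ_two, map_add, hs.1, hs.2]
    linear_combination -(ZMod.castHom (dvd_refl 2) F (M r 0 1) *
      ZMod.castHom (dvd_refl 2) F (M s 0 1)) * hw

/-- The possible shapes of a unital subring of index two, given as the kernel of `f`, in a ring
of `S(4)`. -/
theorem MemS.index_two_cases (hR : MemS 4 R) (f : R →+ ZMod 2)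
    (hf : ∀ r s, f r = 0 → f s = 0 → f (r * s) = 0) {x : R} (hx : f x = 1) (h1 : f 1 = 0) :
    Nonempty (R ≃+* Matrix (Fin 2) (Fin 2) (ZMod 2)) ∨
      (∃ l : R →+* ZMod 2, IsSkewDerivation l l f) ∨
      ∃ φ : R →+* GaloisField 2 2, ∀ r, f r = 0 ↔ φ r * φ r = φ r := by
  have hchar : ∀ l m : R →+* ZMod 2, l = m := by
    intro l m
    by_contra h
    have := coveringNumber_le_three_of_characters h
    rw [hR.1] at this
    exact absurd this (by decide)
  have h2 : (2 : ZMod 2) = 0 := by decide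
  let M := matrixHom f hf x hx h1
  have hMf : ∀ r, M r 0 1 = f r := fun r => rfl
  have hmul : ∀ r s i j, M (r * s) i j = M r i 0 * M s 0 j + M r i 1 * M s 1 j := by
    intro r s i j
    rw [map_mul, Matrix.mul_apply, Fin.sum_univ_two]
  -- The line of `(0, 1)` is fixed: the image is upper triangular, with characters on the diagonal.
  by_cases hcol : ∀ r, M r 1 0 = 0
  · right; left
    let l : R →+* ZMod 2 :=
      { toFun := fun r => M r 0 0
        map_one' := by simp
        map_zero' := by simp
        map_add' := fun r s => by simp
        map_mul' := fun r s => by rw [hmul, hcol s, mul_zero, add_zero] }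
    let m : R →+* ZMod 2 :=
      { toFun := fun r => M r 1 1
        map_one' := by simp
        map_zero' := by simp
        map_add' := fun r s => by simp
        map_mul' := fun r s => by rw [hmul, hcol r, zero_mul, zero_add] }
    have hlm : IsSkewDerivation l m f := by
      intro r s
      show M (r * s) 0 1 = M r 0 1 * M s 1 1 + M r 0 0 * M s 0 1
      rw [hmul, add_comm]
    rw [hchar m l] at hlm
    exact ⟨l, hlm⟩
  -- The line of `(1, 1)` is fixed: `m` below is the eigenvalue on it, `l` the one on the quotient.
  by_cases hdiag : ∀ r, M r 0 0 + M r 1 0 = M r 0 1 + M r 1 1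
  · right; left
    let l : R →+* ZMod 2 :=
      { toFun := fun r => M r 0 0 + M r 0 1
        map_one' := by simp
        map_zero' := by simp
        map_add' := fun r s => by simp only [map_add, Matrix.add_apply]; ring
        map_mul' := fun r s => by
          rw [hmul, hmul]
          linear_combination (M r 0 1) * hdiag s + (M r 0 1 * M s 1 1 - M r 0 1 * M s 0 0) * h2 }
    let m : R →+* ZMod 2 :=
      { toFun := fun r => M r 0 0 + M r 1 0
        map_one' := by simp
        map_zero' := by simp
        map_add' := fun r s => by simp only [map_add, Matrix.add_apply]; ring
        map_mul' := fun r s => by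
          rw [hmul, hmul]
          linear_combination -(M s 1 0) * hdiag r }
    have hlm : IsSkewDerivation l m f := by
      intro r s
      show M (r * s) 0 1 = M r 0 1 * (M s 0 0 + M s 1 0) + (M r 0 0 + M r 0 1) * M s 0 1
      rw [hmul]
      linear_combination -(M r 0 1) * hdiag s - (M r 0 1 * M s 0 1) * h2
    rw [hchar m l] at hlm
    exact ⟨l, hlm⟩
  -- The third line, that of `(1, 0)`, is never fixed by the whole image, because `f x = 1`.
  push Not at hcol hdiag
  obtain ⟨a, ha⟩ := hcol
  obtain ⟨b, hb⟩ := hdiag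
  have hw : orderThree ∈ M.range := Subring.orderThree_mem (m := M x) ⟨x, rfl⟩ ⟨a, rfl⟩ ⟨b, rfl⟩
    (by rw [hMf, hx]; decide) ha hb
  rcases Subring.eq_top_or_commute_orderThree M.range hw with htop | hcomm
  · left
    exact hR.nonempty_ringEquiv M (RingHom.range_eq_top.1 htop) memS_four_matrix.1.le
  · right; right
    obtain ⟨w, hww, -⟩ := GaloisField.four_elements
    refine ⟨fieldHom M (fun r => hcomm _ ⟨r, rfl⟩) hww, fun r => ?_⟩
    have hne : ∀ c : ZMod 2, c = 0 ∨ c = 1 := by decide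
    have h2F : (2 : GaloisField 2 2) = 0 := CharP.cast_eq_zero _ 2
    show _ ↔ (ZMod.castHom (dvd_refl 2) (GaloisField 2 2) (M r 0 0) +
        ZMod.castHom (dvd_refl 2) (GaloisField 2 2) (M r 0 1) * w) *
      (ZMod.castHom (dvd_refl 2) (GaloisField 2 2) (M r 0 0) +
        ZMod.castHom (dvd_refl 2) (GaloisField 2 2) (M r 0 1) * w) =
      (ZMod.castHom (dvd_refl 2) (GaloisField 2 2) (M r 0 0) +
        ZMod.castHom (dvd_refl 2) (GaloisField 2 2) (M r 0 1) * w)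
    rw [← hMf]
    rcases hne (M r 0 1) with h | h <;> rcases hne (M r 0 0) with h' | h' <;>
      simp only [h, h', map_zero, map_one, zero_mul, one_mul, add_zero, zero_add, mul_one,
        mul_zero]
    · refine iff_of_false one_ne_zero fun h => one_ne_zero (α := GaloisField 2 2) ?_
      linear_combination h - hww
    · refine iff_of_false one_ne_zero fun h => one_ne_zero (α := GaloisField 2 2) ?_
      linear_combination h - hww - w * h2F

/-- Two homomorphisms to the field with four elements with incomparable preimages of the prime
field induce a surjection onto the square of that field. -/
theorem MemS.of_two_fieldHoms (hR : MemS 4 R) (φ ψ : R →+* GaloisField 2 2) {x y : R}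
    (hφx : φ x * φ x = φ x) (hψx : ψ x * ψ x ≠ ψ x)
    (hφy : φ y * φ y ≠ φ y) (hψy : ψ y * ψ y = ψ y) :
    Nonempty (R ≃+* GaloisField 2 2 × GaloisField 2 2) := by
  obtain ⟨w, hw, hall⟩ := GaloisField.four_elements
  have h2 : (2 : GaloisField 2 2) = 0 := CharP.cast_eq_zero _ 2
  have hgen : ∀ a : GaloisField 2 2, a * a ≠ a → a * a - a = 1 ∧ (w = a ∨ w = a + 1) := by
    intro a ha
    rcases hall a with rfl | rfl | rfl | rfl
    · simp at ha
    · simp at ha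
    · exact ⟨by rw [hw]; ring, Or.inl rfl⟩
    · exact ⟨by linear_combination hw + w * h2, Or.inr (by linear_combination -h2)⟩
  have hsurj : ∀ (χ : R →+* GaloisField 2 2) (z : R), χ z * χ z ≠ χ z →
      Function.Surjective χ := by
    intro χ z hz c
    obtain ⟨z', hz'⟩ : ∃ z', χ z' = w := by
      rcases (hgen _ hz).2 with h | h
      · exact ⟨z, h.symm⟩
      · exact ⟨z + 1, by rw [map_add, map_one, h]⟩
    rcases hall c with rfl | rfl | rfl | rfl
    · exact ⟨0, map_zero _⟩
    · exact ⟨1, map_one _⟩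
    · exact ⟨z', hz'⟩
    · exact ⟨z' + 1, by rw [map_add, map_one, hz']⟩
  refine hR.nonempty_ringEquiv (φ.prod ψ) ?_ memS_four_galoisField_prod.1.le
  rintro ⟨c, d⟩
  obtain ⟨r, rfl⟩ := hsurj φ y hφy c
  obtain ⟨s, rfl⟩ := hsurj ψ x hψx d
  -- `y² - y` and `x² - x` map to the idempotents `(1, 0)` and `(0, 1)`.
  refine ⟨r * (y * y - y) + s * (x * x - x), Prod.ext ?_ ?_⟩
  · show φ _ = φ r
    simp only [map_add, map_mul, map_sub, (hgen _ hφy).1, hφx]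
    ring
  · show ψ _ = ψ s
    simp only [map_add, map_mul, map_sub, (hgen _ hψx).1, hψy]
    ring

end Two

theorem AddSubgroup.exists_ker_eq_of_index_prime {G : Type*} [AddCommGroup G] (K : AddSubgroup G)
    {p : ℕ} (hp : p.Prime) (hK : K.index = p) :
    ∃ f : G →+ ZMod p, (∀ g, f g = 0 ↔ g ∈ K) ∧ ∃ g, f g = 1 := by
  have : Fact p.Prime := ⟨hp⟩
  have hcard : Nat.card (G ⧸ K) = p := hK
  have : IsAddCyclic (G ⧸ K) := isAddCyclic_of_prime_card hcard
  let e : ZMod p ≃+ G ⧸ K := (ZMod.ringEquivCongr hcard.symm).toAddEquiv.trans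
    (zmodAddCyclicAddEquiv this)
  refine ⟨(e.symm : G ⧸ K →+ ZMod p).comp (QuotientAddGroup.mk' K), fun g => ?_, ?_⟩
  · simp
  · obtain ⟨g, hg⟩ := QuotientAddGroup.mk'_surjective K (e 1)
    exact ⟨g, by simp only [AddMonoidHom.comp_apply, hg]; simp⟩

/-! ### Reduction to covers by unital subrings. -/

section Normalize

variable {R : Type*} [Ring R]

/-- The subring generated by a subring and the identity. -/
def NonUnitalSubring.adjoinOne (S : NonUnitalSubring R) : NonUnitalSubring R where
  carrier := {r | ∃ s ∈ S, ∃ k : ℤ, r = s + k}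
  zero_mem' := ⟨0, S.zero_mem, 0, by simp⟩
  add_mem' := by
    rintro _ _ ⟨s, hs, k, rfl⟩ ⟨t, ht, m, rfl⟩
    exact ⟨s + t, add_mem hs ht, k + m, by push_cast; abel⟩
  neg_mem' := by
    rintro _ ⟨s, hs, k, rfl⟩
    exact ⟨-s, neg_mem hs, -k, by push_cast; abel⟩
  mul_mem' := by
    rintro _ _ ⟨s, hs, k, rfl⟩ ⟨t, ht, m, rfl⟩
    refine ⟨s * t + m • s + k • t, add_mem (add_mem (mul_mem hs ht) (zsmul_mem hs m))
      (zsmul_mem ht k), k * m, ?_⟩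
    rw [zsmul_eq_mul, zsmul_eq_mul, (Int.cast_commute m s).eq, add_mul, mul_add, mul_add]
    push_cast
    abel

/-- A ring of covering number four has an irredundant cover by four proper subrings, each of
which contains the identity or together with the identity generates the ring. -/
theorem exists_normalized_cover (h : coveringNumber R = 4) :
    ∃ H : Fin 4 → NonUnitalSubring R, (∀ r, ∃ i, r ∈ H i) ∧
      (∀ i, ∃ x, ∀ j, j ≠ i → x ∉ H j) ∧
      ∀ i, 1 ∈ H i ∨ ∀ r, ∃ s ∈ H i, ∃ k : ℤ, r = s + k := by
  classical
  obtain ⟨H, hH, hcov⟩ := exists_family_of_coveringNumber_eq (n := 4) h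
  let H' : Fin 4 → NonUnitalSubring R := fun i =>
    if (H i).adjoinOne = ⊤ then H i else (H i).adjoinOne
  have hle : ∀ i, ∀ r ∈ H i, r ∈ H' i := by
    intro i r hr
    simp only [H']
    split_ifs
    · exact hr
    · exact ⟨r, hr, 0, by simp⟩
  have hne : ∀ i, H' i ≠ ⊤ := by
    intro i
    simp only [H']
    split_ifs with hi
    · exact hH i
    · exact hi
  have hcov' : ∀ r, ∃ i, r ∈ H' i := fun r => by
    obtain ⟨i, hi⟩ := hcov r
    exact ⟨i, hle i r hi⟩
  refine ⟨H', hcov', fun i => ?_, fun i => ?_⟩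
  · by_contra! hno
    have := coveringNumber_le_of_family (fun k : Fin 3 => H' (i.succAbove k)) (fun k => hne _)
      (fun r => by
        obtain ⟨j, hj, hr⟩ := hno r
        obtain ⟨k, rfl⟩ := Fin.exists_succAbove_eq hj
        exact ⟨k, hr⟩)
    rw [h] at this
    exact absurd this (by decide)
  · simp only [H']
    split_ifs with hi
    · right
      intro r
      have : r ∈ (H i).adjoinOne := hi ▸ NonUnitalSubring.mem_top r
      exact this
    · exact Or.inl ⟨0, (H i).zero_mem, 1, by simp⟩

/-- A subring not containing the identity that generates the ring together with it, and whose
index divides a power of two, lies in the kernel of a character to `ZMod 2`. -/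
theorem NonUnitalSubring.exists_character {S : NonUnitalSubring R} (h1 : (1 : R) ∉ S)
    (h4 : (4 : R) ∈ S) (hS : ∀ r, ∃ s ∈ S, ∃ k : ℤ, r = s + k) :
    ∃ l : R →+* ZMod 2, ∀ r ∈ S, l r = 0 := by
  have heven : ∀ k : ℤ, (k : R) ∈ S → (k : ZMod 2) = 0 := by
    intro k hk
    rw [ZMod.intCast_zmod_eq_zero_iff_dvd]
    by_contra hodd
    obtain ⟨m, rfl⟩ : Odd k := by
      rw [← Int.not_even_iff_odd]
      exact fun h => hodd (even_iff_two_dvd.1 h)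
    refine h1 ?_
    -- An odd square is 1 modulo 4, so an odd integer in `S` would put 1 in `S`. Hence the parity of
    -- `k` in `r = s + k` is well defined.
    have e : (1 : R) = ((2 * m + 1 : ℤ) : R) * ((2 * m + 1 : ℤ) : R) - (m * (m + 1)) • (4 : R) := by
      rw [zsmul_eq_mul, ← Int.cast_mul, show (4 : R) = ((4 : ℤ) : R) by simp, ← Int.cast_mul,
        ← Int.cast_sub, show (2 * m + 1) * (2 * m + 1) - m * (m + 1) * 4 = 1 by ring, Int.cast_one]
    rw [e]
    exact sub_mem (mul_mem hk hk) (zsmul_mem h4 _)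
  choose s hs k hk using hS
  have huniq : ∀ (r : R) (n : ℤ), r - (n : R) ∈ S → (k r : ZMod 2) = n := by
    intro r n hn
    have : ((k r - n : ℤ) : R) ∈ S := by
      have h := sub_mem hn (hs r)
      rw [show r - (n : R) - s r = ((k r - n : ℤ) : R) by
        push_cast; nth_rewrite 1 [hk r]; abel] at h
      exact h
    have h := heven _ this
    push_cast at h
    exact sub_eq_zero.1 h
  have hdiff : ∀ r, r - (k r : R) ∈ S := fun r => by
    have : r - (k r : R) = s r := by nth_rewrite 1 [hk r]; abel
    rw [this]
    exact hs r
  refine ⟨{ toFun := fun r => (k r : ZMod 2), map_one' := ?_, map_zero' := ?_,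
            map_add' := ?_, map_mul' := ?_ }, fun r hr => ?_⟩
  · simpa using huniq 1 1 (by simp)
  · intro a b
    have h := huniq (a * b) (k a * k b) (by
      have h := add_mem (add_mem (mul_mem (hdiff a) (hdiff b)) (zsmul_mem (hdiff a) (k b)))
        (zsmul_mem (hdiff b) (k a))
      rw [zsmul_eq_mul, zsmul_eq_mul, (Int.cast_commute (k b) _).eq] at h
      convert h using 1
      push_cast
      noncomm_ring)
    simpa using h
  · simpa using huniq 0 0 (by simp)
  · intro a b
    have h := huniq (a + b) (k a + k b) (by
      have h := add_mem (hdiff a) (hdiff b)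
      convert h using 1
      push_cast
      abel)
    simpa using h
  · simpa using huniq r 0 (by simpa using hr)

/-- In a normalized irredundant cover whose members contain `4`, every member contains `1`. -/
theorem one_mem_of_cover (hR : coveringNumber R = 4) {H : Fin 4 → NonUnitalSubring R}
    (hcov : ∀ r, ∃ i, r ∈ H i) (hirr : ∀ i, ∃ x, ∀ j, j ≠ i → x ∉ H j)
    (hone : ∀ i, 1 ∈ H i ∨ ∀ r, ∃ s ∈ H i, ∃ k : ℤ, r = s + k) (h4 : ∀ i, (4 : R) ∈ H i)
    (i : Fin 4) : 1 ∈ H i := by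
  classical
  by_contra hi
  -- Were 1 in all other members, `x` and `x + 1` would both lie in `H i` alone, for `x` in no other
  -- member.
  obtain ⟨j, hji, hj⟩ : ∃ j, j ≠ i ∧ (1 : R) ∉ H j := by
    by_contra! hall
    obtain ⟨x, hx⟩ := hirr i
    have hmem : ∀ y, (∀ j, j ≠ i → y ∉ H j) → y ∈ H i := by
      intro y hy
      obtain ⟨j, hj⟩ := hcov y
      by_cases hji : j = i
      · exact hji ▸ hj
      · exact absurd hj (hy j hji)
    have hx1 := hmem (x + 1) fun j hj h => hx j hj (by simpa using sub_mem h (hall j hj))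
    exact hi (by simpa using sub_mem hx1 (hmem x hx))
  obtain ⟨l, hl⟩ := NonUnitalSubring.exists_character hi (h4 i) ((hone i).resolve_left hi)
  obtain ⟨m, hm⟩ := NonUnitalSubring.exists_character hj (h4 j) ((hone j).resolve_left hj)
  have hlm : l = m := by
    by_contra h
    have := coveringNumber_le_three_of_characters h
    rw [hR] at this
    exact absurd this (by decide)
  subst hlm
  let K : NonUnitalSubring R := kerSubring (l : R →+ ZMod 2) (by
    intro r s hr _
    simp only [AddMonoidHom.coe_coe] at hr ⊢
    rw [map_mul, hr, zero_mul])
  -- Both `H i` and `H j` lie in the kernel of the common character; this kernel replaces the two,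
  -- leaving a cover by three.
  let H' : Fin 4 → NonUnitalSubring R := fun n => if n = i then K else H n
  have hne : ∀ n, H' n ≠ ⊤ := by
    intro n
    simp only [H']
    split_ifs with hn
    · exact kerSubring_ne_top (r := 1) (by simp)
    · obtain ⟨x, hx⟩ := hirr i
      exact NonUnitalSubring.ne_top_of_notMem (hx n hn)
  have hHi : H' i = K := if_pos rfl
  have := coveringNumber_le_of_family (fun n : Fin 3 => H' (j.succAbove n)) (fun n => hne _)
    (fun r => by
      obtain ⟨n, hn⟩ := hcov r
      by_cases hnK : n = i ∨ n = j
      · obtain ⟨k, hk⟩ := Fin.exists_succAbove_eq hji.symm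
        refine ⟨k, ?_⟩
        show r ∈ H' (j.succAbove k)
        rw [hk, hHi]
        rcases hnK with rfl | rfl
        · exact hl r hn
        · exact hm r hn
      · push Not at hnK
        obtain ⟨k, hk⟩ := Fin.exists_succAbove_eq hnK.2
        refine ⟨k, ?_⟩
        show r ∈ H' (j.succAbove k)
        rw [hk, show H' n = H n from if_neg hnK.1]
        exact hn)
  rw [hR] at this
  exact absurd this (by decide)

end Normalize

/-! ### Identification of the rings in `S(4)`. -/

section Classification

variable {R : Type*} [Ring R]

/-- The case of a cover by four subrings of index three. -/
theorem MemS.of_index_three (hR : MemS 4 R) {H : Fin 4 → NonUnitalSubring R}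
    (hirr : ∀ i, ∃ x, ∀ j, j ≠ i → x ∉ H j) (hcov : ∀ r, ∃ i, r ∈ H i)
    (hidx : ∀ i, (H i).toAddSubgroup.index = 3)
    (hmeet : ∀ i j l, j ≠ i → l ≠ i → j ≠ l → ∀ x, x ∈ H j → x ∈ H l → x ∈ H i) :
    Nonempty (R ≃+* TruncatedPoly (ZMod 3)) ∨ Nonempty (R ≃+* upperTriangular (ZMod 3)) := by
  have honly : ∀ i, ∃ x ∈ H i, ∀ j, j ≠ i → x ∉ H j := by
    intro i
    obtain ⟨x, hx⟩ := hirr i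
    obtain ⟨j, hj⟩ := hcov x
    have : j = i := by
      by_contra h
      exact hx j h hj
    exact ⟨x, this ▸ hj, hx⟩
  obtain ⟨f, hf, -⟩ := (H 0).toAddSubgroup.exists_ker_eq_of_index_prime Nat.prime_three (hidx 0)
  obtain ⟨g, hg, -⟩ := (H 1).toAddSubgroup.exists_ker_eq_of_index_prime Nat.prime_three (hidx 1)
  replace hf : ∀ r, f r = 0 ↔ r ∈ H 0 := hf
  replace hg : ∀ r, g r = 0 ↔ r ∈ H 1 := hg
  have hscale : ∀ (h : R →+ ZMod 3) (S : NonUnitalSubring R), ∀ x ∈ S, h x ≠ 0 →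
      ∃ y ∈ S, h y = 1 := by
    intro h S x hx hne
    exact ⟨((h x)⁻¹).val • x, nsmul_mem hx _, by rw [map_val_nsmul, inv_mul_cancel₀ hne]⟩
  obtain ⟨x, hx1, hfx⟩ : ∃ x ∈ H 1, f x = 1 := by
    obtain ⟨x, hx, hx'⟩ := honly 1
    exact hscale f _ x hx fun h => hx' 0 (by decide) ((hf x).1 h)
  obtain ⟨y, hy0, hgy⟩ : ∃ y ∈ H 0, g y = 1 := by
    obtain ⟨x, hx, hx'⟩ := honly 0
    exact hscale g _ x hx fun h => hx' 1 (by decide) ((hg x).1 h)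
  have hgx := (hg x).2 hx1
  have hfy := (hf y).2 hy0
  have hline : ∀ k, k ≠ 0 → k ≠ 1 →
      (∀ r, r ∈ H k ↔ (f - g) r = 0) ∨ ∀ r, r ∈ H k ↔ (f + g) r = 0 := by
    intro k hk0 hk1
    have hbit : ∀ c : ZMod 3, c ≠ 0 → c = 1 ∨ c = -1 := by decide
    obtain ⟨z, hz, hfz⟩ : ∃ z ∈ H k, f z = 1 := by
      obtain ⟨x, hx, hx'⟩ := honly k
      exact hscale f _ x hx fun h => hx' 0 hk0.symm ((hf x).1 h)
    have hgz : g z ≠ 0 := fun h => by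
      have := hmeet 0 1 k (by decide) hk0 hk1.symm z ((hg z).1 h) hz
      rw [(hf z).2 this] at hfz
      exact zero_ne_one hfz
    have hmem : ∀ r, r ∈ H k ↔ g r = f r * g z := by
      intro r
      have hfr : f (r - (f r).val • z) = 0 := by
        rw [map_sub, map_val_nsmul, hfz, mul_one, sub_self]
      have hgr : g (r - (f r).val • z) = g r - f r * g z := by rw [map_sub, map_val_nsmul]
      constructor
      · intro hr
        have h1 := hmeet 1 0 k (by decide) hk1 hk0.symm _ ((hf _).1 hfr)
          (sub_mem hr (nsmul_mem hz (f r).val))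
        rw [← hg, hgr] at h1
        exact sub_eq_zero.1 h1
      · intro hr
        rw [hr, sub_self] at hgr
        have h1 := hmeet k 0 1 hk0.symm hk1.symm (by decide) _ ((hf _).1 hfr) ((hg _).1 hgr)
        simpa using add_mem h1 (nsmul_mem hz (f r).val)
    rcases hbit _ hgz with h | h
    · left
      intro r
      rw [hmem, h, mul_one, AddMonoidHom.sub_apply, sub_eq_zero, eq_comm]
    · right
      intro r
      rw [hmem, h, mul_neg_one, AddMonoidHom.add_apply, eq_neg_iff_add_eq_zero, add_comm]
  have hmul : ∀ (k : Fin 4) (h : R →+ ZMod 3), (∀ r, r ∈ H k ↔ h r = 0) →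
      ∀ r s, h r = 0 → h s = 0 → h (r * s) = 0 := by
    intro k h hk r s hr hs
    rw [← hk] at hr hs ⊢
    exact mul_mem hr hs
  have hdistinct : ∀ h : R →+ ZMod 3, (∀ r, r ∈ H 2 ↔ h r = 0) → (∀ r, r ∈ H 3 ↔ h r = 0) →
      False := by
    intro h h2 h3
    obtain ⟨x, hx, hx'⟩ := honly 2
    exact hx' 3 (by decide) ((h3 x).2 ((h2 x).1 hx))
  obtain ⟨hsub, hadd⟩ : (∀ r s, (f - g) r = 0 → (f - g) s = 0 → (f - g) (r * s) = 0) ∧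
      ∀ r s, (f + g) r = 0 → (f + g) s = 0 → (f + g) (r * s) = 0 := by
    rcases hline 2 (by decide) (by decide) with h2 | h2 <;>
      rcases hline 3 (by decide) (by decide) with h3 | h3
    · exact (hdistinct _ h2 h3).elim
    · exact ⟨hmul 2 _ h2, hmul 3 _ h3⟩
    · exact ⟨hmul 3 _ h3, hmul 2 _ h2⟩
    · exact (hdistinct _ h2 h3).elim
  obtain ⟨l, m, hlf, hlg⟩ := exists_characters_of_ker_mul f g hfx hgx hfy hgy
    (hmul 0 f fun r => (hf r).symm) (hmul 1 g fun r => (hg r).symm) hadd hsub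
  exact hR.of_derivations hlf hlg hfx hgx hfy hgy

/-- If a subring contains `1` and an element separating a homomorphism to the field with four
elements from a character with a derivation, it maps onto the product. -/
theorem exists_mem_same_image {S : NonUnitalSubring R} (h1 : (1 : R) ∈ S)
    (φ : R →+* GaloisField 2 2) (l : R →+* ZMod 2) (f : R →+ ZMod 2)
    (hf : IsSkewDerivation l l f) {z : R} (hz : z ∈ S) (hφz : φ z * φ z ≠ φ z) (hfz : f z ≠ 0)
    (r : R) : ∃ h ∈ S, φ (r - h) = 0 ∧ f (r - h) = 0 := by
  obtain ⟨w, hw, hall⟩ := GaloisField.four_elements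
  have h2 : (2 : GaloisField 2 2) = 0 := CharP.cast_eq_zero _ 2
  have hbit : ∀ c : ZMod 2, c = 0 ∨ c = 1 := by decide
  -- In `F₄ × F₂[ε]`, `u` maps to a generator of `F₄` paired with `ε`. Squaring kills `ε`, so `u³`
  -- and `u⁴` map to `(1, 0)` and `(φ u, 0)`, separating the factors.
  obtain ⟨u, hu, hφu, hlu, hfu⟩ : ∃ u ∈ S, (φ u = w ∨ φ u = w + 1) ∧ l u = 0 ∧ f u = 1 := by
    have hφ : φ z = w ∨ φ z = w + 1 := by
      rcases hall (φ z) with h | h | h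
      · rw [h] at hφz; simp at hφz
      · rw [h] at hφz; simp at hφz
      · exact h
    have hfz1 := (hbit (f z)).resolve_left hfz
    rcases hbit (l z) with h | h
    · exact ⟨z, hz, hφ, h, hfz1⟩
    · refine ⟨z + 1, add_mem hz h1, ?_, ?_, ?_⟩
      · rw [map_add, map_one]
        rcases hφ with h | h
        · exact Or.inr (by rw [h])
        · exact Or.inl (by linear_combination h + h2)
      · rw [map_add, map_one, h]; decide
      · rw [map_add, hf.map_one, hfz1, add_zero]
  have hquad : φ u * φ u = φ u + 1 := by
    rcases hφu with h | h <;> rw [h]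
    · exact hw
    · linear_combination hw + w * h2
  have hfq : f (u * u) = 0 := by rw [hf, hlu]; simp
  have hlq : l (u * u) = 0 := by rw [map_mul, hlu, zero_mul]
  have hp : u * u * u ∈ S := mul_mem (mul_mem hu hu) hu
  have hq : u * u * (u * u) ∈ S := mul_mem (mul_mem hu hu) (mul_mem hu hu)
  have hfp : f (u * u * u) = 0 := by rw [hf, hfq, hlq]; simp
  have hfqq : f (u * u * (u * u)) = 0 := by rw [hf, hfq]; simp
  have hφp : φ (u * u * u) = 1 := by
    simp only [map_mul]
    linear_combination (φ u + 1) * hquad + φ u * h2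
  have hφq : φ (u * u * (u * u)) = φ u := by
    rw [← mul_assoc, map_mul, hφp, one_mul]
  have hfield : ∀ c, ∃ h ∈ S, φ h = c ∧ f h = 0 := by
    intro c
    obtain ⟨v, hv, hφv, hfv⟩ : ∃ v ∈ S, φ v = w ∧ f v = 0 := by
      rcases hφu with h | h
      · exact ⟨_, hq, by rw [hφq, h], hfqq⟩
      · exact ⟨_, add_mem hq hp, by rw [map_add, hφq, hφp, h]; linear_combination h2,
          by rw [map_add, hfqq, hfp, add_zero]⟩
    rcases hall c with rfl | rfl | rfl | rfl
    · exact ⟨0, S.zero_mem, map_zero _, map_zero _⟩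
    · exact ⟨_, hp, hφp, hfp⟩
    · exact ⟨v, hv, hφv, hfv⟩
    · exact ⟨v + u * u * u, add_mem hv hp, by rw [map_add, hφv, hφp],
        by rw [map_add, hfv, hfp, add_zero]⟩
  rcases hbit (f r) with h | h
  · obtain ⟨s, hs, hφs, hfs⟩ := hfield (φ r)
    exact ⟨s, hs, by rw [map_sub, hφs, sub_self], by rw [map_sub, h, hfs, sub_self]⟩
  · obtain ⟨s, hs, hφs, hfs⟩ := hfield (φ r - φ u)
    exact ⟨s + u, add_mem hs hu, by rw [map_sub, map_add, hφs]; ring,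
      by rw [map_sub, map_add, h, hfs, hfu]; decide⟩

/-- The case of a cover with two subrings of index two. -/
theorem MemS.of_index_two (hR : MemS 4 R) {H : Fin 4 → NonUnitalSubring R}
    (hcov : ∀ r, ∃ i, r ∈ H i) (hirr : ∀ i, ∃ x, ∀ j, j ≠ i → x ∉ H j)
    (hone : ∀ i, 1 ∈ H i ∨ ∀ r, ∃ s ∈ H i, ∃ k : ℤ, r = s + k) {i j : Fin 4} (hij : i ≠ j)
    (hi : (H i).toAddSubgroup.index = 2) (hj : (H j).toAddSubgroup.index = 2) :
    Nonempty (R ≃+* GaloisField 2 2 × GaloisField 2 2) ∨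
      Nonempty (R ≃+* Matrix (Fin 2) (Fin 2) (ZMod 2)) := by
  have honly : ∀ i, ∃ x ∈ H i, ∀ j, j ≠ i → x ∉ H j := by
    intro i
    obtain ⟨x, hx⟩ := hirr i
    obtain ⟨j, hj⟩ := hcov x
    have : j = i := by
      by_contra h
      exact hx j h hj
    exact ⟨x, this ▸ hj, hx⟩
  obtain ⟨k, l, hki, hkj, hli, hlj, hkl, hall⟩ : ∃ k l : Fin 4, k ≠ i ∧ k ≠ j ∧ l ≠ i ∧ l ≠ j ∧
      k ≠ l ∧ ∀ n, n = i ∨ n = j ∨ n = k ∨ n = l := by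
    clear hi hj
    revert i j
    decide
  have hadd : ∀ n, (H n).toAddSubgroup.index = 2 → ∀ {r s}, r + s ∈ H n ↔ (r ∈ H n ↔ s ∈ H n) :=
    fun n hn {r s} => AddSubgroup.add_mem_iff_of_index_two hn
  have hout : ∀ r, r ∉ H i → r ∉ H j → r ∉ H k → r ∈ H l := by
    intro r hri hrj hrk
    obtain ⟨n, hn⟩ := hcov r
    rcases hall n with rfl | rfl | rfl | rfl
    · exact absurd hn hri
    · exact absurd hn hrj
    · exact absurd hn hrk
    · exact hn
  obtain ⟨z, hzk, hz⟩ := honly k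
  obtain ⟨y, hyl, hy⟩ := honly l
  have hlk : ∀ d, d ∈ H i → d ∈ H j → d ∈ H l → d ∈ H k := by
    intro d hdi hdj hdl
    by_contra hdk
    have h1 : z + d ∈ H l := by
      refine hout _ ?_ ?_ fun h => hdk (by simpa using sub_mem h hzk)
      · exact fun h => hz i hki.symm (by simpa using sub_mem h hdi)
      · exact fun h => hz j hkj.symm (by simpa using sub_mem h hdj)
    exact hz l hkl.symm (by simpa using sub_mem h1 hdl)
  have hei : y - z ∈ H i := by
    rw [sub_eq_add_neg, hadd i hi, neg_mem_iff]
    exact iff_of_false (hy i hli.symm) (hz i hki.symm)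
  have hej : y - z ∈ H j := by
    rw [sub_eq_add_neg, hadd j hj, neg_mem_iff]
    exact iff_of_false (hy j hlj.symm) (hz j hkj.symm)
  have hek : y - z ∉ H k := fun h => hy k hkl (by simpa using add_mem h hzk)
  -- Within `H i ∩ H j`, the complement of `H k` is a single coset, represented by `y - z`.
  have htrans : ∀ c, c ∈ H i → c ∈ H j → c ∉ H k → c - (y - z) ∈ H k := by
    intro c hci hcj hck
    have h1 : z + c ∈ H l := by
      refine hout _ ?_ ?_ fun h => hck (by simpa using sub_mem h hzk)
      · exact fun h => hz i hki.symm (by simpa using sub_mem h hci)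
      · exact fun h => hz j hkj.symm (by simpa using sub_mem h hcj)
    refine hlk _ (sub_mem hci hei) (sub_mem hcj hej) ?_
    have := sub_mem h1 hyl
    rwa [show z + c - y = c - (y - z) by abel] at this
  have hkl' : ∀ d, d ∈ H i → d ∈ H j → d ∈ H k → d ∈ H l := by
    intro d hdi hdj hdk
    have h1 : y + d ∈ H l := by
      refine hout _ ?_ ?_ fun h => hy k hkl (by simpa using sub_mem h hdk)
      · exact fun h => hy i hli.symm (by simpa using sub_mem h hdi)
      · exact fun h => hy j hlj.symm (by simpa using sub_mem h hdj)
    simpa using sub_mem h1 hyl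
  have h2i : (2 : R) ∈ H i := by
    rw [← one_add_one_eq_two, hadd i hi]
  have h2j : (2 : R) ∈ H j := by
    rw [← one_add_one_eq_two, hadd j hj]
  have h22 : (4 : R) = 2 + 2 := by norm_num
  have h4i : (4 : R) ∈ H i := h22 ▸ add_mem h2i h2i
  have h4j : (4 : R) ∈ H j := h22 ▸ add_mem h2j h2j
  -- If 2 is not in `H k`, then 2 and -2 lie in the same coset, and their difference is 4.
  have h4k : (4 : R) ∈ H k := by
    rw [h22]
    by_cases h : (2 : R) ∈ H k
    · exact add_mem h h
    · have h1 := htrans 2 h2i h2j h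
      have h2 := htrans (-2) (neg_mem h2i) (neg_mem h2j) (by rwa [neg_mem_iff])
      have := sub_mem h1 h2
      rwa [show (2 : R) - (y - z) - (-2 - (y - z)) = 2 + 2 by abel] at this
  have h4 : ∀ n, (4 : R) ∈ H n := by
    intro n
    rcases hall n with rfl | rfl | rfl | rfl
    · exact h4i
    · exact h4j
    · exact h4k
    · exact hkl' _ h4i h4j h4k
  have h1 := one_mem_of_cover hR.1 hcov hirr hone h4
  let IsFieldType : Fin 4 → Prop := fun n =>
    ∃ φ : R →+* GaloisField 2 2, ∀ r, r ∈ H n ↔ φ r * φ r = φ r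
  let IsDualType : Fin 4 → Prop := fun n =>
    ∃ (c : R →+* ZMod 2) (f : R →+ ZMod 2), IsSkewDerivation c c f ∧ ∀ r, r ∈ H n ↔ f r = 0
  have hcases : ∀ n, (H n).toAddSubgroup.index = 2 →
      Nonempty (R ≃+* Matrix (Fin 2) (Fin 2) (ZMod 2)) ∨ IsDualType n ∨ IsFieldType n := by
    intro n hn
    obtain ⟨f, hf, x, hx⟩ := (H n).toAddSubgroup.exists_ker_eq_of_index_prime Nat.prime_two hn
    replace hf : ∀ r, f r = 0 ↔ r ∈ H n := hf
    rcases hR.index_two_cases f (fun r s hr hs => (hf _).2 (mul_mem ((hf r).1 hr) ((hf s).1 hs)))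
      hx ((hf 1).2 (h1 n)) with h | ⟨c, hc⟩ | ⟨φ, hφ⟩
    · exact Or.inl h
    · exact Or.inr (Or.inl ⟨c, f, hc, fun r => (hf r).symm⟩)
    · exact Or.inr (Or.inr ⟨φ, fun r => (hf r).symm.trans (hφ r)⟩)
  have hfield : ∀ n m, n ≠ m → IsFieldType n → IsFieldType m →
      Nonempty (R ≃+* GaloisField 2 2 × GaloisField 2 2) := by
    rintro n m hnm ⟨φ, hφ⟩ ⟨ψ, hψ⟩
    obtain ⟨x, hx, hx'⟩ := honly n
    obtain ⟨x', hxm, hxm'⟩ := honly m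
    exact hR.of_two_fieldHoms φ ψ ((hφ x).1 hx) (fun h => hx' m hnm.symm ((hψ x).2 h))
      (fun h => hxm' n hnm ((hφ x').2 h)) ((hψ x').1 hxm)
  have hdual : ∀ n m, n ≠ m → IsDualType n → IsDualType m → False := by
    rintro n m hnm ⟨c, f, hcf, hf⟩ ⟨d, g, hdg, hg⟩
    have hcd : c = d := by
      by_contra h
      have := coveringNumber_le_three_of_characters h
      rw [hR.1] at this
      exact absurd this (by decide)
    subst hcd
    obtain ⟨x, hx, hx'⟩ := honly n
    obtain ⟨x', hxm, hxm'⟩ := honly m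
    have hgx : g x ≠ 0 := fun h => hx' m hnm.symm ((hg x).2 h)
    have hfx : f x' ≠ 0 := fun h => hxm' n hnm ((hf x').2 h)
    have := coveringNumber_le_three_of_derivations hcf hdg hfx hgx (z := x)
      (by rw [(hf x).1 hx]; exact hgx.symm)
    rw [hR.1] at this
    exact absurd this (by decide)
  -- As `z` lies in `H k` but in neither `H a` nor `H b`, `H k` has the same image as `R` under `(φ,
  -- f)`. Thus `R = H k + (H i ∩ H j)`, and the index of `H k` can be computed inside `H i ∩ H j`,
  -- where it is 2.
  have hmixed : ∀ a b, ((a = i ∧ b = j) ∨ (a = j ∧ b = i)) → IsFieldType a → IsDualType b →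
      (H k).toAddSubgroup.index = 2 := by
    rintro a b hab ⟨φ, hφ⟩ ⟨c, f, hcf, hf⟩
    have hza : z ∉ H a := hz a (by rcases hab with ⟨rfl, -⟩ | ⟨rfl, -⟩ <;> exact Ne.symm ‹_›)
    have hzb : z ∉ H b := hz b (by rcases hab with ⟨-, rfl⟩ | ⟨-, rfl⟩ <;> exact Ne.symm ‹_›)
    have hboth : ∀ d, d ∈ H a → d ∈ H b → d ∈ H i ∧ d ∈ H j := by
      intro d hda hdb
      rcases hab with ⟨rfl, rfl⟩ | ⟨rfl, rfl⟩
      · exact ⟨hda, hdb⟩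
      · exact ⟨hdb, hda⟩
    refine AddSubgroup.index_eq_two_iff_exists_notMem_and.2 ⟨-(y - z), ?_, fun r => ?_⟩
    · intro h
      exact hek (by simpa using neg_mem h)
    · obtain ⟨s, hs, hφs, hfs⟩ := exists_mem_same_image (h1 k) φ c f hcf hzk
        (fun h => hza ((hφ z).2 h)) (fun h => hzb ((hf z).2 h)) r
      have hd := hboth (r - s) ((hφ _).2 (by rw [hφs, zero_mul])) ((hf _).2 hfs)
      by_cases hk : r - s ∈ H k
      · right
        show r ∈ H k
        simpa using add_mem hk hs
      · left
        show r + -(y - z) ∈ H k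
        have := add_mem (htrans _ hd.1 hd.2 hk) hs
        rwa [show r - s - (y - z) + s = r + -(y - z) by abel] at this
  rcases hcases i hi with h | hi' | hi'
  · exact Or.inr h
  · rcases hcases j hj with h | hj' | hj'
    · exact Or.inr h
    · exact (hdual i j hij hi' hj').elim
    · rcases hcases k (hmixed j i (Or.inr ⟨rfl, rfl⟩) hj' hi') with h | hk' | hk'
      · exact Or.inr h
      · exact (hdual i k hki.symm hi' hk').elim
      · exact Or.inl (hfield j k hkj.symm hj' hk')
  · rcases hcases j hj with h | hj' | hj'
    · exact Or.inr h
    · rcases hcases k (hmixed i j (Or.inl ⟨rfl, rfl⟩) hi' hj') with h | hk' | hk'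
      · exact Or.inr h
      · exact (hdual j k hkj.symm hj' hk').elim
      · exact Or.inl (hfield i k hki.symm hi' hk')
    · exact Or.inl (hfield i j hij hi' hj')

/-- Finiteness of `R` is not assumed: the cover itself supplies subgroups of finite index. -/
theorem MemS.classification (hR : MemS 4 R) :
    Nonempty (R ≃+* TruncatedPoly (ZMod 3)) ∨ Nonempty (R ≃+* upperTriangular (ZMod 3)) ∨
      Nonempty (R ≃+* GaloisField 2 2 × GaloisField 2 2) ∨
      Nonempty (R ≃+* Matrix (Fin 2) (Fin 2) (ZMod 2)) := by
  obtain ⟨H, hcov, hirr, hone⟩ := exists_normalized_cover hR.1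
  rcases AddSubgroup.irredundant_cover_four (H := fun i => (H i).toAddSubgroup) hcov hirr with
    ⟨i, j, hij, hi, hj⟩ | ⟨hidx, hmeet⟩
  · exact Or.inr (Or.inr (hR.of_index_two hcov hirr hone hij hi hj))
  · rcases hR.of_index_three hirr hcov hidx hmeet with h | h
    · exact Or.inl h
    · exact Or.inr (Or.inl h)

end Classification

/-! ### Orders of the four rings and the final statement. -/

/-- A nontrivial ring annihilated by `p` does not have order a power of some `q` coprime to
`p`. -/
theorem card_ne_pow_of_coprime {R T : Type*} [Ring R] [Ring T] [Nontrivial T] (e : R ≃+* T)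
    {p q t : ℕ} (hp : (p : T) = 0) (hpq : p.Coprime q) : Nat.card R ≠ q ^ t := by
  intro hcard
  rw [Nat.card_congr e.toEquiv] at hcard
  have h1 : addOrderOf (1 : T) ∣ p := addOrderOf_dvd_of_nsmul_eq_zero (by simpa using hp)
  have h2 : addOrderOf (1 : T) ∣ q ^ t := hcard ▸ addOrderOf_dvd_natCard 1
  have h3 : addOrderOf (1 : T) = 1 := Nat.eq_one_of_dvd_coprimes (hpq.pow_right t) h1 h2
  exact one_ne_zero (AddMonoid.addOrderOf_eq_one_iff.1 h3)

theorem truncatedPoly_three_eq_zero : ((3 : ℕ) : TruncatedPoly (ZMod 3)) = 0 := by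
  rw [← map_natCast (algebraMap (ZMod 3) (TruncatedPoly (ZMod 3))),
    show ((3 : ℕ) : ZMod 3) = 0 by decide, map_zero]

theorem theorem2 (R : Type*) [Ring R] :
    (MemS 4 R → ∀ t : ℕ, Nat.card R = 3 ^ t →
      Nonempty (R ≃+* TruncatedPoly (ZMod 3)) ∨
        Nonempty (R ≃+* upperTriangular (ZMod 3))) ∧
    (MemS 4 R → ∀ t : ℕ, Nat.card R = 2 ^ t →
      Nonempty (R ≃+* GaloisField 2 2 × GaloisField 2 2) ∨
        Nonempty (R ≃+* Matrix (Fin 2) (Fin 2) (ZMod 2))) ∧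
    (MemS 4 R ↔
      Nonempty (R ≃+* TruncatedPoly (ZMod 3)) ∨
        Nonempty (R ≃+* upperTriangular (ZMod 3)) ∨
        Nonempty (R ≃+* GaloisField 2 2 × GaloisField 2 2) ∨
        Nonempty (R ≃+* Matrix (Fin 2) (Fin 2) (ZMod 2))) := by
  have : Nontrivial (TruncatedPoly (ZMod 3)) :=
    (TruncatedPoly.coeffs (ZMod 3)).domain_nontrivial
  refine ⟨fun hR t ht => ?_, fun hR t ht => ?_, fun hR => hR.classification, ?_⟩
  · rcases hR.classification with h | h | ⟨⟨e⟩⟩ | ⟨⟨e⟩⟩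
    · exact Or.inl h
    · exact Or.inr h
    · exact absurd ht (card_ne_pow_of_coprime e (p := 2)
        (Prod.ext (CharP.cast_eq_zero _ 2) (CharP.cast_eq_zero _ 2)) (by norm_num))
    · exact absurd ht (card_ne_pow_of_coprime e (p := 2) (by decide) (by norm_num))
  · rcases hR.classification with ⟨⟨e⟩⟩ | ⟨⟨e⟩⟩ | h | h
    · exact absurd ht (card_ne_pow_of_coprime e truncatedPoly_three_eq_zero (by norm_num))
    · exact absurd ht (card_ne_pow_of_coprime e (p := 3)
        (Subtype.ext (show ((3 : ℕ) : Matrix (Fin 2) (Fin 2) (ZMod 3)) = 0 by decide))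
        (by norm_num))
    · exact Or.inl h
    · exact Or.inr h
  · rintro (⟨⟨e⟩⟩ | ⟨⟨e⟩⟩ | ⟨⟨e⟩⟩ | ⟨⟨e⟩⟩)
    · exact memS_four_truncatedPoly.of_ringEquiv e
    · exact memS_four_upperTriangular.of_ringEquiv e
    · exact memS_four_galoisField_prod.of_ringEquiv e
    · exact memS_four_matrix.of_ringEquiv e
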